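/- For a finite simple graph $H$ on at least two vertices let $\lambda_2(H)$ be the second smallest eigenvalue, counted with multiplicity, of its Laplacian matrix. Fix $d\ge 1$ and $p\in[0,1]$. For $r=0,1,2,\dots$ let $G_r$ be a simple graph on the $n=n(r)=(r+1)^d$ points of $[0,r]^d$ with integer coordinates. Assume that the family is locally connected: there is a fixed $\delta$ such that, for all $r$, all neighbours of each vertex $x$ of $G_r$ lie within Euclidean distance $\delta$ of $x$, measured either in the hypercube or in the hypertorus with $r+1$ lattice points on each coordinate circle. Let $q=q(r)$ be the average vertex degree of $G_r$. For a graph $\Delta$ on the same vertices ("the added edges") let $\tilde G=G_r\cup\Delta$ be the simple graph whose edges are those of $G_r$ and of $\Delta$. Then: 1. For every $r\ge 1$ and every $\Delta$ with at most $p\binom n2$ edges, if $\tilde G$ is not complete or $p=1$, then $\lambda_2(\tilde G)\le pn+q$. Moreover, there is an $r_0$ such that for all $r\ge r_0$ the bound $\lambda_2(\tilde G)\le pn+q$ holds for every $\Delta$ with at most $p\binom n2$ edges, without exception. 2. Let $\Delta$ be random, either for all $r$ uniformly distributed among the graphs with exactly $\lfloor p\binom n2\rfloor$ edges (a random fraction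 $p$ of all possible edges), or for all $r$ the random graph $G(n,p)$, in which each possible edge is present independently with probability $p$. Then, as $r\to\infty$ (so $n\to\infty$), $\lambda_2(\tilde G)\le pn+q$ with probability tending to $1$, and $\lambda_2(\tilde G)=pn+o(n^{1/2+\varepsilon})$ in probability for every $\varepsilon>0$, that is, for all $\varepsilon,\eta>0$, $$\Pr\left(|\lambda_2(\tilde G)-pn|>\eta\, n^{1/2+\varepsilon}\right)\to 0 .$$ In particular $\lambda_2(\tilde G)$ grows linearly in $p$ and in $n$: $\lambda_2(\tilde G)/n\to p$ in probability. -/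

import Mathlib

open Filter Topology MeasureTheory ProbabilityTheory

noncomputable section

namespace RandomCoupling

/-- The second smallest eigenvalue (counted with multiplicity) of a real symmetric matrix of
order at least `2`. Mathlib lists the eigenvalues `eigenvalues₀` in decreasing order, so it is the
entry with index `n - 2` of `0, …, n - 1`. Orders `0` and `1` get the value `0`. -/
def secondSmallestEigenvalue {V : Type*} [Fintype V] [DecidableEq V] {A : Matrix V V ℝ}
    (hA : A.IsHermitian) : ℝ :=
  if h : 2 ≤ Fintype.card V then hA.eigenvalues₀ ⟨Fintype.card V - 2, by omega⟩ else 0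

open Classical in
/-- `lam2 H` is the algebraic connectivity of the graph `H`: the second smallest eigenvalue
of its Laplacian matrix. -/
def lam2 {V : Type*} [Fintype V] (H : SimpleGraph V) : ℝ :=
  secondSmallestEigenvalue (A := H.lapMatrix ℝ) (H.isHermitian_lapMatrix ℝ)

open Classical in
/-- The average vertex degree (average number of connections) of a finite graph. -/
def avgDegree {V : Type*} [Fintype V] (H : SimpleGraph V) : ℝ :=
  (∑ v, (H.degree v : ℝ)) / Fintype.card V

/-- The points with integer coordinates in the hypercube `[0, r]^d`. -/
abbrev Lattice (d r : ℕ) : Type := Fin d → Fin (r + 1)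

/-- Euclidean distance between lattice points of the hypercube `[0, r]^d`. -/
def cubeDist {d r : ℕ} (x y : Lattice d r) : ℝ :=
  Real.sqrt (∑ i, |((x i : ℕ) : ℝ) - ((y i : ℕ) : ℝ)| ^ 2)

/-- Euclidean distance between the same points, with the hypercube closed up to a flat hypertorus
with `r + 1` lattice points on each coordinate circle. -/
def torusDist {d r : ℕ} (x y : Lattice d r) : ℝ :=
  Real.sqrt (∑ i, (min |((x i : ℕ) : ℝ) - ((y i : ℕ) : ℝ)|
    ((r : ℝ) + 1 - |((x i : ℕ) : ℝ) - ((y i : ℕ) : ℝ)|)) ^ 2)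

/-- A family of graphs on the hypercubes `[0, r]^d`, `r = 0, 1, 2, …`, is locally connected:
for one fixed `δ`, all neighbours of each vertex `x` are in the `δ`-neighbourhood of `x`. -/
def LocallyConnectedCube {d : ℕ} (G : ∀ r : ℕ, SimpleGraph (Lattice d r)) : Prop :=
  ∃ δ : ℝ, ∀ (r : ℕ) (x y : Lattice d r), (G r).Adj x y → cubeDist x y ≤ δ

/-- The same notion when the hypercube is considered as a hypertorus. -/
def LocallyConnectedTorus {d : ℕ} (G : ∀ r : ℕ, SimpleGraph (Lattice d r)) : Prop :=
  ∃ δ : ℝ, ∀ (r : ℕ) (x y : Lattice d r), (G r).Adj x y → torusDist x y ≤ δ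

/-- The law of a random graph with a fraction `p` of all possible edges: all graphs on `V` with
exactly `⌊p * (|V| choose 2)⌋` edges are equally likely. -/
def fixedFractionRandom (V : Type*) [Fintype V] (p : unitInterval) : Measure (SimpleGraph V) :=
  uniformOn {H : SimpleGraph V |
    H.edgeSet.ncard = ⌊(p : ℝ) * ((Fintype.card V).choose 2 : ℝ)⌋₊}

end RandomCoupling

end

/-! On vectors with sum zero, `lam2` is the minimum Rayleigh quotient of `lapForm`
(`lam2_mul_le_lapForm`, `le_lam2_of_forall_le_lapForm`).

Deterministic bound. In a graph that is not complete, `lam2` is at most every vertex degree, hence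
at most the average degree (`lam2_le_avgDegree`), and added edges of density `p` raise the average
degree by at most `p (n - 1)`. Local connectivity bounds all degrees of `G r` by a constant
(`exists_degree_le`), so for `p < 1` and large `r` the union cannot be complete; for `p = 1` the
trivial bound `lam2 ≤ n` is enough.

Concentration. In `G(n, s)`, Hoeffding's inequality and a union bound over a grid net of the unit
sphere control the degrees, the centered quadratic form and the edge count with error `t = n ^ (1 /
2 + k)` (`binomialRandom_real_not_concentrated_le`). Then `lapForm` is `s n |x|²` up to `2 t |x|²`
on vectors with sum zero, which gives the lower bound for `lam2`. The model with exactly `M` edges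
is dominated by `G(n, M / N)`, `N` being the number of possible edges, at the cost of a factor `N +
1`, which the exponential tails absorb.

Sharp upper bound for `G(n, p)`. The random edge count may exceed its mean, so the average degree
does not suffice. Suppose `lam2 > μ = p n + q`. Then `L - μ (I - J / n)`, with `L` the Laplacian of
the union and `J` the all-ones matrix, is positive semidefinite with norm `O(t)` and trace `O(√n
t)`, so its squared Frobenius norm is `O(√n t²)`, that is `O(n ^ (7 / 4))` for `k = 1 / 8`. But its
off-diagonal entries are `μ / n` or `μ / n - 1`, bounded away from zero, which forces order `n²`
(`card_mul_le_of_lt_lam2`). -/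

namespace RandomCoupling

/-! ### Variational characterisation of the second smallest Laplacian eigenvalue. -/

open Matrix in
/-- Spectral decomposition of a real symmetric matrix in coordinates, with the eigenvalues in
decreasing order. -/
theorem exists_orthonormal_eigenvectors {V : Type*} [Fintype V] [DecidableEq V]
    {A : Matrix V V ℝ} (hA : A.IsHermitian) :
    ∃ u : Fin (Fintype.card V) → V → ℝ,
      (∀ j k, u j ⬝ᵥ u k = if j = k then 1 else 0) ∧
      (∀ k, A *ᵥ u k = hA.eigenvalues₀ k • u k) ∧
      (∀ x y : V → ℝ, x ⬝ᵥ y = ∑ k, (x ⬝ᵥ u k) * (y ⬝ᵥ u k)) := by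
  -- This is the enumeration used inside `IsHermitian.eigenvalues`, so that `eigenvalues₀ k` belongs
  -- to the basis vector `e k`.
  set e : Fin (Fintype.card V) ≃ V := Fintype.equivOfCardEq (Fintype.card_fin _) with he
  have hin : ∀ x y : EuclideanSpace ℝ V, inner ℝ x y = x.ofLp ⬝ᵥ y.ofLp := by
    intro x y
    rw [EuclideanSpace.inner_eq_star_dotProduct, star_trivial, dotProduct_comm]
  refine ⟨fun k => (hA.eigenvectorBasis (e k)).ofLp, ?_, ?_, ?_⟩
  · intro j k
    rw [← hin, orthonormal_iff_ite.1 hA.eigenvectorBasis.orthonormal]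
    simp
  · intro k
    rw [hA.mulVec_eigenvectorBasis, IsHermitian.eigenvalues]
    congr 2
    exact e.symm_apply_apply k
  · intro x y
    have h := hA.eigenvectorBasis.sum_inner_mul_inner (WithLp.toLp 2 x) (WithLp.toLp 2 y)
    rw [hin] at h
    rw [← h, ← e.sum_comp]
    refine Finset.sum_congr rfl fun k _ => ?_
    rw [hin, hin, dotProduct_comm _ (WithLp.toLp 2 y).ofLp]

open Classical in
/-- The quadratic form of the graph Laplacian. -/
noncomputable def lapForm {V : Type*} [Fintype V] (H : SimpleGraph V) (x : V → ℝ) : ℝ :=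
  (∑ i, ∑ j, if H.Adj i j then (x i - x j) ^ 2 else 0) / 2

open Classical in
theorem dotProduct_lapMatrix_mulVec {V : Type*} [Fintype V] (H : SimpleGraph V) (x : V → ℝ) :
    x ⬝ᵥ (H.lapMatrix ℝ).mulVec x = lapForm H x := by
  rw [← Matrix.toLinearMap₂'_apply', SimpleGraph.lapMatrix_toLinearMap₂', lapForm]

theorem lapForm_nonneg {V : Type*} [Fintype V] (H : SimpleGraph V) (x : V → ℝ) :
    0 ≤ lapForm H x := by
  unfold lapForm
  positivity

open Matrix in
/-- Every vector orthogonal to the constants has Rayleigh quotient at least `lam2 H`. -/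
theorem lam2_mul_le_lapForm {V : Type*} [Fintype V] (hV : 2 ≤ Fintype.card V)
    (H : SimpleGraph V) {x : V → ℝ} (hx : ∑ i, x i = 0) :
    lam2 H * ∑ i, x i ^ 2 ≤ lapForm H x := by
  classical
  have hA := H.isHermitian_lapMatrix ℝ
  obtain ⟨u, hu, hAu, hsum⟩ := exists_orthonormal_eigenvectors hA
  set l : ℝ := hA.eigenvalues₀ ⟨Fintype.card V - 2, by omega⟩ with hl
  have hlam : lam2 H = l := by
    unfold lam2 secondSmallestEigenvalue
    rw [dif_pos hV]
  have hxx : ∑ i, x i ^ 2 = x ⬝ᵥ x := by simp [dotProduct, sq]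
  have hsymm : ∀ y k, (H.lapMatrix ℝ *ᵥ y) ⬝ᵥ u k = hA.eigenvalues₀ k * (y ⬝ᵥ u k) := by
    intro y k
    rw [← smul_eq_mul, ← dotProduct_smul, ← hAu, dotProduct_mulVec, ← mulVec_transpose,
      (H.isSymm_lapMatrix (R := ℝ)).eq]
  have hform : lapForm H x = ∑ k, hA.eigenvalues₀ k * (x ⬝ᵥ u k) ^ 2 := by
    have := dotProduct_lapMatrix_mulVec H x
    rw [← this, hsum]
    refine Finset.sum_congr rfl fun k _ => ?_
    have h2 := hsymm x k
    rw [show (H.lapMatrix ℝ *ᵥ x) ⬝ᵥ u k = hA.eigenvalues₀ k * (x ⬝ᵥ u k) by convert h2]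
    ring
  rw [hlam, hxx]
  -- For `l ≤ 0` nonnegativity of the form suffices. For `l > 0` every eigenvector but the last has
  -- a positive eigenvalue and so is orthogonal to the constants, which lie in the kernel. The last
  -- one then spans the constants, and `x` has no component along it.
  rcases le_or_gt l 0 with hl0 | hl0
  · refine le_trans (mul_nonpos_of_nonpos_of_nonneg hl0 ?_) (lapForm_nonneg H x)
    rw [← hxx]; positivity
  have hpos : ∀ k : Fin (Fintype.card V), (k : ℕ) ≤ Fintype.card V - 2 → l ≤ hA.eigenvalues₀ k := fun k hk =>
    hA.eigenvalues₀_antitone (show k ≤ ⟨Fintype.card V - 2, by omega⟩ from hk)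
  let last : Fin (Fintype.card V) := ⟨Fintype.card V - 1, by omega⟩
  have hle : ∀ k : Fin (Fintype.card V), k ≠ last → (k : ℕ) ≤ Fintype.card V - 2 := by
    intro k hk
    have : (k : ℕ) ≠ Fintype.card V - 1 := fun h => hk (Fin.ext h)
    omega
  have hone : ∀ k : Fin (Fintype.card V), k ≠ last → (fun _ : V => (1 : ℝ)) ⬝ᵥ u k = 0 := by
    intro k hk
    have h1 := hsymm (fun _ => 1) k
    rw [SimpleGraph.lapMatrix_mulVec_const_eq_zero, zero_dotProduct] at h1
    have := hpos k (hle k hk)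
    rcases mul_eq_zero.1 h1.symm with h | h
    · linarith
    · exact h
  have hxlast : x ⬝ᵥ u last = 0 := by
    have h1 := hsum x (fun _ => 1)
    rw [Finset.sum_eq_single last (fun k _ hk => by rw [hone k hk, mul_zero]) (by simp)] at h1
    have h2 := hsum (fun _ => (1 : ℝ)) (fun _ => 1)
    rw [Finset.sum_eq_single last (fun k _ hk => by rw [hone k hk, mul_zero]) (by simp)] at h2
    have h3 : x ⬝ᵥ (fun _ => (1 : ℝ)) = 0 := by simpa [dotProduct] using hx
    rw [h3] at h1
    rcases mul_eq_zero.1 h1.symm with h | h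
    · exact h
    · rw [h] at h2
      have : (Fintype.card V : ℝ) = 0 := by simpa [dotProduct] using h2
      have : Fintype.card V = 0 := by exact_mod_cast this
      omega
  rw [hform, hsum, Finset.mul_sum]
  refine Finset.sum_le_sum fun k _ => ?_
  by_cases hk : k = last
  · rw [hk, hxlast]; simp
  · rw [← sq]
    exact mul_le_mul_of_nonneg_right (hpos k (hle k hk)) (sq_nonneg _)

theorem lam2_le_of_lapForm_le {V : Type*} [Fintype V] (hV : 2 ≤ Fintype.card V)
    (H : SimpleGraph V) {x : V → ℝ} (hx : ∑ i, x i = 0) (hx0 : 0 < ∑ i, x i ^ 2) {c : ℝ}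
    (h : lapForm H x ≤ c * ∑ i, x i ^ 2) : lam2 H ≤ c :=
  le_of_mul_le_mul_right ((lam2_mul_le_lapForm hV H hx).trans h) hx0

open Matrix in
-- The span of the eigenvectors of the two smallest eigenvalues has dimension two, so it meets the
-- hyperplane of sum zero in a nonzero vector, whose Rayleigh quotient is at most `lam2 H`.
theorem le_lam2_of_forall_le_lapForm {V : Type*} [Fintype V] (hV : 2 ≤ Fintype.card V)
    (H : SimpleGraph V) {c : ℝ}
    (h : ∀ x : V → ℝ, ∑ i, x i = 0 → c * ∑ i, x i ^ 2 ≤ lapForm H x) : c ≤ lam2 H := by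
  classical
  have hA := H.isHermitian_lapMatrix ℝ
  obtain ⟨u, hu, hAu, -⟩ := exists_orthonormal_eigenvectors hA
  let i : Fin (Fintype.card V) := ⟨Fintype.card V - 2, by omega⟩
  let j : Fin (Fintype.card V) := ⟨Fintype.card V - 1, by omega⟩
  have hlam : lam2 H = hA.eigenvalues₀ i := by
    unfold lam2 secondSmallestEigenvalue
    rw [dif_pos hV]
  have hij : i ≠ j := by simp only [i, j, ne_eq, Fin.mk.injEq]; omega
  have hle : hA.eigenvalues₀ j ≤ hA.eigenvalues₀ i :=
    hA.eigenvalues₀_antitone (show Fintype.card V - 2 ≤ Fintype.card V - 1 by omega)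
  obtain ⟨α, β, hαβ, h0⟩ : ∃ α β : ℝ, 0 < α ^ 2 + β ^ 2 ∧
      α * ∑ v, u i v + β * ∑ v, u j v = 0 := by
    by_cases hz : ∑ v, u i v = 0
    · exact ⟨1, 0, by norm_num, by simp [hz]⟩
    · refine ⟨∑ v, u j v, -∑ v, u i v, ?_, by ring⟩
      have : 0 < (-∑ v, u i v) ^ 2 := by rw [neg_sq]; positivity
      have := sq_nonneg (∑ v, u j v)
      linarith
  let x : V → ℝ := α • u i + β • u j
  have hx : ∑ v, x v = 0 := by
    simp only [x, Pi.add_apply, Pi.smul_apply, smul_eq_mul, Finset.sum_add_distrib,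
      ← Finset.mul_sum]
    exact h0
  have hxx : ∑ v, x v ^ 2 = α ^ 2 + β ^ 2 := by
    have : ∑ v, x v ^ 2 = x ⬝ᵥ x := by simp [dotProduct, sq]
    rw [this]
    simp only [x, add_dotProduct, dotProduct_add, smul_dotProduct, dotProduct_smul, hu, hij,
      hij.symm, if_true, if_false, smul_eq_mul]
    ring
  have hform : lapForm H x = α ^ 2 * hA.eigenvalues₀ i + β ^ 2 * hA.eigenvalues₀ j := by
    have := dotProduct_lapMatrix_mulVec H x
    rw [← this]
    have hmul : H.lapMatrix ℝ *ᵥ x = α • (hA.eigenvalues₀ i • u i) +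
        β • (hA.eigenvalues₀ j • u j) := by
      rw [← hAu, ← hAu, ← mulVec_smul, ← mulVec_smul, ← mulVec_add]
    rw [hmul]
    simp only [x, add_dotProduct, dotProduct_add, smul_dotProduct, dotProduct_smul, hu, hij,
      hij.symm, if_true, if_false, smul_eq_mul]
    ring
  have h1 := h x hx
  rw [hform, hxx] at h1
  rw [hlam]
  refine le_of_mul_le_mul_right (h1.trans ?_) hαβ
  nlinarith [mul_le_mul_of_nonneg_left hle (sq_nonneg β)]

/-! ### Deterministic upper bounds by degrees and edge counts. -/

section

variable {V : Type*} [Fintype V]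

theorem lapForm_le_card_mul (H : SimpleGraph V) {x : V → ℝ} (hx : ∑ i, x i = 0) :
    lapForm H x ≤ Fintype.card V * ∑ i, x i ^ 2 := by
  classical
  have h1 : lapForm H x ≤ (∑ i, ∑ j, (x i - x j) ^ 2) / 2 := by
    unfold lapForm
    gcongr with i _ j _
    split_ifs
    · exact le_rfl
    · positivity
  refine h1.trans (le_of_eq ?_)
  have : ∀ i, ∑ j, (x i - x j) ^ 2 = Fintype.card V * x i ^ 2 + ∑ j, x j ^ 2 := by
    intro i
    have : ∀ j, (x i - x j) ^ 2 = x i ^ 2 + x j ^ 2 - 2 * x i * x j := fun j => by ring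
    simp only [this, Finset.sum_sub_distrib, Finset.sum_add_distrib, ← Finset.mul_sum, hx]
    simp
  simp only [this, Finset.sum_add_distrib, ← Finset.mul_sum]
  simp

theorem exists_sum_eq_zero_of_two_le_card (hV : 2 ≤ Fintype.card V) :
    ∃ x : V → ℝ, ∑ i, x i = 0 ∧ 0 < ∑ i, x i ^ 2 := by
  classical
  obtain ⟨u, v, huv⟩ := Fintype.one_lt_card_iff.1 hV
  refine ⟨fun i => (if i = u then 1 else 0) - (if i = v then 1 else 0), by simp, ?_⟩
  refine Finset.sum_pos' (fun i _ => sq_nonneg _) ⟨u, Finset.mem_univ _, ?_⟩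
  simp [huv]

theorem lam2_le_card (hV : 2 ≤ Fintype.card V) (H : SimpleGraph V) :
    lam2 H ≤ Fintype.card V := by
  obtain ⟨x, hx, hx0⟩ := exists_sum_eq_zero_of_two_le_card hV
  exact lam2_le_of_lapForm_le hV H hx hx0 (lapForm_le_card_mul H hx)

open Classical in
/-- The algebraic connectivity is at most the degree of any vertex that misses another vertex. -/
theorem lam2_le_degree_of_not_adj (hV : 2 ≤ Fintype.card V) (H : SimpleGraph V) {v z : V}
    (hvz : z ≠ v) (hadj : ¬ H.Adj v z) : lam2 H ≤ H.degree v := by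
  let a : V → ℝ := fun i => if i = v then 1 else 0
  let b : V → ℝ := fun i => if H.Adj v i then 1 else 0
  let w : V → ℝ := fun i => 1 - a i - b i
  set m : ℝ := ∑ i, w i with hm
  have hsa : ∑ i, a i = 1 := by simp [a]
  have hsb : ∑ i, b i = H.degree v := (H.degree_eq_sum_if_adj v).symm
  have hcases : ∀ i, (i = v ∧ a i = 1 ∧ b i = 0 ∧ w i = 0) ∨
      (H.Adj v i ∧ a i = 0 ∧ b i = 1 ∧ w i = 0) ∨
      (i ≠ v ∧ ¬ H.Adj v i ∧ a i = 0 ∧ b i = 0 ∧ w i = 1) := by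
    intro i
    by_cases hi : i = v
    · left; simp [hi, a, b, w]
    · by_cases hvi : H.Adj v i
      · right; left; simp [hi, hvi, a, b, w]
      · right; right; simp [hi, hvi, a, b, w]
  have hmpos : 0 < m := by
    refine Finset.sum_pos' (fun i _ => ?_) ⟨z, Finset.mem_univ _, ?_⟩
    · rcases hcases i with h | h | h <;> simp [h.2]
    · simp [w, a, b, hvz, hadj]
  -- The vector is `m` at `v`, `0` on its neighbours and `-1` on the `m` remaining vertices. Edges
  -- at `v` contribute `m ^ 2` each, and at most `degree v * m` edges join neighbours to the rest,
  -- contributing `1` each; no edge joins `v` to the rest.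
  let x : V → ℝ := fun i => m * a i - w i
  have hx : ∑ i, x i = 0 := by
    simp only [x, Finset.sum_sub_distrib, ← Finset.mul_sum, hsa]
    simp [hm]
  have hxx : ∑ i, x i ^ 2 = m ^ 2 + m := by
    have : ∀ i, x i ^ 2 = m ^ 2 * a i + w i := by
      intro i
      rcases hcases i with h | h | h <;> simp [h.2, x]
    simp only [this, Finset.sum_add_distrib, ← Finset.mul_sum, hsa]
    simp [hm]
  refine lam2_le_of_lapForm_le hV H hx (by rw [hxx]; positivity) ?_
  rw [hxx]
  have hterm : ∀ i j, (if H.Adj i j then (x i - x j) ^ 2 else 0) ≤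
      m ^ 2 * (a i * b j) + m ^ 2 * (b i * a j) + b i * w j + w i * b j := by
    intro i j
    have h0 : 0 ≤ m ^ 2 := sq_nonneg m
    rcases hcases i with ⟨h, hi⟩ | ⟨h, hi⟩ | ⟨h, h', hi⟩ <;>
    rcases hcases j with ⟨k, hj⟩ | ⟨k, hj⟩ | ⟨k, k', hj⟩ <;>
    split_ifs with hij <;> simp_all [x, SimpleGraph.adj_comm]
  calc lapForm H x ≤ (∑ i, ∑ j, (m ^ 2 * (a i * b j) + m ^ 2 * (b i * a j) + b i * w j
        + w i * b j)) / 2 := by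
        unfold lapForm
        gcongr with i _ j _
        exact hterm i j
    _ = H.degree v * (m ^ 2 + m) := by
        simp only [Finset.sum_add_distrib, ← Finset.mul_sum, hsb, ← hm]
        simp only [← Finset.sum_mul, hsa, hsb, ← hm]
        ring

open Classical in
-- A vertex adjacent to all others has the maximal degree `n - 1`, so the bound from a vertex that
-- misses another one carries over to it.
theorem lam2_le_degree_of_ne_top (hV : 2 ≤ Fintype.card V) (H : SimpleGraph V) (hH : H ≠ ⊤)
    (v : V) : lam2 H ≤ H.degree v := by
  by_cases hv : ∃ z, z ≠ v ∧ ¬ H.Adj v z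
  · obtain ⟨z, hz, hadj⟩ := hv
    exact lam2_le_degree_of_not_adj hV H hz hadj
  · obtain ⟨u, z, huz, hadj⟩ := SimpleGraph.ne_top_iff_exists_not_adj.1 hH
    refine (lam2_le_degree_of_not_adj hV H huz.symm hadj).trans ?_
    push Not at hv
    have h1 : H.neighborFinset v = Finset.univ.erase v := by
      ext z
      simp only [SimpleGraph.mem_neighborFinset, Finset.mem_erase, Finset.mem_univ, and_true]
      exact ⟨fun h => h.ne', hv z⟩
    have h2 : H.degree v = Fintype.card V - 1 := by
      rw [← H.card_neighborFinset_eq_degree, h1, Finset.card_erase_of_mem (Finset.mem_univ _),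
        Finset.card_univ]
    have h3 := H.degree_lt_card_verts u
    exact_mod_cast (by omega : H.degree u ≤ H.degree v)

theorem avgDegree_nonneg (H : SimpleGraph V) : 0 ≤ avgDegree H := by
  unfold avgDegree
  positivity

theorem lam2_le_avgDegree (hV : 2 ≤ Fintype.card V) (H : SimpleGraph V) (hH : H ≠ ⊤) :
    lam2 H ≤ avgDegree H := by
  classical
  unfold avgDegree
  rw [le_div_iff₀ (by exact_mod_cast (by omega : 0 < Fintype.card V)), mul_comm, ← nsmul_eq_mul,
    ← Finset.card_univ, ← Finset.sum_const]
  exact Finset.sum_le_sum fun v _ => by convert lam2_le_degree_of_ne_top hV H hH v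

open Classical in
theorem sum_degree_eq_two_mul_ncard (H : SimpleGraph V) :
    ∑ v, (H.degree v : ℝ) = 2 * H.edgeSet.ncard := by
  rw [Set.ncard_eq_toFinset_card' H.edgeSet]
  exact_mod_cast H.sum_degrees_eq_twice_card_edges

theorem avgDegree_eq (H : SimpleGraph V) :
    avgDegree H = 2 * H.edgeSet.ncard / Fintype.card V := by
  classical
  rw [← sum_degree_eq_two_mul_ncard]
  rfl

theorem ncard_edgeSet_sup_le {V : Type*} (G Δ : SimpleGraph V) :
    (G ⊔ Δ).edgeSet.ncard ≤ G.edgeSet.ncard + Δ.edgeSet.ncard := by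
  rw [SimpleGraph.edgeSet_sup]
  exact Set.ncard_union_le _ _

theorem avgDegree_sup_le (G Δ : SimpleGraph V) :
    avgDegree (G ⊔ Δ) ≤ avgDegree G + 2 * Δ.edgeSet.ncard / Fintype.card V := by
  rw [avgDegree_eq, avgDegree_eq, ← add_div]
  gcongr
  have : ((G ⊔ Δ).edgeSet.ncard : ℝ) ≤ G.edgeSet.ncard + Δ.edgeSet.ncard := by
    exact_mod_cast ncard_edgeSet_sup_le G Δ
  linarith

theorem avgDegree_sup_le_of_ncard_le (hV : 2 ≤ Fintype.card V) (G Δ : SimpleGraph V) {p : ℝ}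
    (hΔ : (Δ.edgeSet.ncard : ℝ) ≤ p * ((Fintype.card V).choose 2 : ℝ)) :
    avgDegree (G ⊔ Δ) ≤ p * (Fintype.card V - 1) + avgDegree G := by
  have hn : (0 : ℝ) < Fintype.card V := by exact_mod_cast (by omega : 0 < Fintype.card V)
  refine (avgDegree_sup_le G Δ).trans ?_
  rw [add_comm, Nat.cast_choose_two] at *
  gcongr
  rw [div_le_iff₀ hn]
  linarith

theorem lam2_sup_le_of_ne_top (hV : 2 ≤ Fintype.card V) (G Δ : SimpleGraph V) {p : ℝ}
    (hp : 0 ≤ p) (hΔ : (Δ.edgeSet.ncard : ℝ) ≤ p * ((Fintype.card V).choose 2 : ℝ))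
    (h : G ⊔ Δ ≠ ⊤) : lam2 (G ⊔ Δ) ≤ p * Fintype.card V + avgDegree G := by
  refine (lam2_le_avgDegree hV _ h).trans ((avgDegree_sup_le_of_ncard_le hV G Δ hΔ).trans ?_)
  gcongr
  linarith

theorem avgDegree_top (hV : 2 ≤ Fintype.card V) :
    avgDegree (⊤ : SimpleGraph V) = Fintype.card V - 1 := by
  classical
  have hn : (Fintype.card V : ℝ) ≠ 0 := by exact_mod_cast (by omega : Fintype.card V ≠ 0)
  have h := SimpleGraph.card_edgeFinset_top_eq_card_choose_two (V := V)
  rw [avgDegree_eq, Set.ncard_eq_toFinset_card']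
  have h' : ((⊤ : SimpleGraph V).edgeSet.toFinset.card) = (Fintype.card V).choose 2 := by
    rw [← h]; congr
  rw [h', Nat.cast_choose_two]
  field_simp

/-- If the average degree of `G` is small then no set of edges of density `p` completes `G`. -/
theorem lam2_sup_le_of_avgDegree_lt (hV : 2 ≤ Fintype.card V) (G Δ : SimpleGraph V) {p : ℝ}
    (hp : 0 ≤ p) (hΔ : (Δ.edgeSet.ncard : ℝ) ≤ p * ((Fintype.card V).choose 2 : ℝ))
    (hG : avgDegree G < (1 - p) * (Fintype.card V - 1)) :
    lam2 (G ⊔ Δ) ≤ p * Fintype.card V + avgDegree G := by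
  refine lam2_sup_le_of_ne_top hV G Δ hp hΔ fun h => ?_
  have h1 := avgDegree_sup_le_of_ncard_le hV G Δ hΔ
  rw [h, avgDegree_top hV] at h1
  linarith

end

/-! ### Local connectivity bounds the degrees; size of the lattices. -/

/-- On a circle with `r + 1` lattice points at most `4 * k + 1` points lie within distance `k` of
a given one. -/
theorem card_filter_circle_le (r k : ℕ) (a : Fin (r + 1)) :
    (Finset.univ.filter fun b : Fin (r + 1) =>
      min |((a : ℕ) : ℝ) - ((b : ℕ) : ℝ)| ((r : ℝ) + 1 - |((a : ℕ) : ℝ) - ((b : ℕ) : ℝ)|) ≤ k).card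
      ≤ 4 * k + 1 := by
  -- Possible differences of coordinates: `2 k + 1` near zero, and `k` at each end for pairs that
  -- are close across the seam of the circle.
  let T : Finset ℤ := Finset.Icc (-k : ℤ) k ∪ (Finset.Ico (r + 1 - k : ℤ) (r + 1) ∪
    Finset.Ico (-r : ℤ) (-r + k))
  have hT : T.card ≤ 4 * k + 1 := by
    refine (Finset.card_union_le _ _).trans ?_
    have h1 := Finset.card_union_le (Finset.Ico (r + 1 - k : ℤ) (r + 1))
      (Finset.Ico (-r : ℤ) (-r + k))
    simp only [Int.card_Icc, Int.card_Ico] at h1 ⊢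
    omega
  refine le_trans ?_ hT
  refine Finset.card_le_card_of_injOn (fun b => ((a : ℕ) : ℤ) - ((b : ℕ) : ℤ)) ?_ ?_
  · intro b hb
    have hb' := (Finset.mem_filter.1 (Finset.mem_coe.1 hb)).2
    have hcast : |((a : ℕ) : ℝ) - ((b : ℕ) : ℝ)| = ((|((a : ℕ) : ℤ) - ((b : ℕ) : ℤ)| : ℤ) : ℝ) := by
      push_cast
      rfl
    rw [hcast] at hb'
    have ha := a.2
    have hb2 := b.2
    simp only [T, Finset.coe_union, Finset.coe_Icc, Finset.coe_Ico, Set.mem_union, Set.mem_Icc,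
      Set.mem_Ico]
    rcases min_le_iff.1 hb' with h | h
    · left
      exact abs_le.1 (by exact_mod_cast h)
    · right
      have h' : (r : ℤ) + 1 - |((a : ℕ) : ℤ) - ((b : ℕ) : ℤ)| ≤ k := by exact_mod_cast h
      rcases abs_cases (((a : ℕ) : ℤ) - ((b : ℕ) : ℤ)) with h3 | h3 <;> omega
  · intro b _ b' _ h
    simp only at h
    exact Fin.ext (by omega)

theorem abs_coord_le_sqrt_sum {ι : Type*} [Fintype ι] (f : ι → ℝ) (i : ι) :
    f i ≤ Real.sqrt (∑ j, f j ^ 2) :=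
  Real.le_sqrt_of_sq_le (Finset.single_le_sum (f := fun j => f j ^ 2)
    (fun _ _ => sq_nonneg _) (Finset.mem_univ i))

open Classical in
-- Both distances dominate the circular distance in each single coordinate, so the neighbours of a
-- vertex lie in a product of `d` sets whose sizes do not depend on `r`.
theorem exists_degree_le {d : ℕ} (G : ∀ r : ℕ, SimpleGraph (Lattice d r))
    (hG : LocallyConnectedCube G ∨ LocallyConnectedTorus G) :
    ∃ C : ℕ, ∀ r v, (G r).degree v ≤ C := by
  obtain ⟨δ, hδ⟩ : ∃ δ : ℝ, ∀ (r : ℕ) (x y : Lattice d r), (G r).Adj x y → ∀ i,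
      min |((x i : ℕ) : ℝ) - ((y i : ℕ) : ℝ)|
        ((r : ℝ) + 1 - |((x i : ℕ) : ℝ) - ((y i : ℕ) : ℝ)|) ≤ δ := by
    rcases hG with ⟨δ, h⟩ | ⟨δ, h⟩
    · exact ⟨δ, fun r x y hxy i => (min_le_left _ _).trans ((abs_coord_le_sqrt_sum
        (fun i => |((x i : ℕ) : ℝ) - ((y i : ℕ) : ℝ)|) i).trans (h r x y hxy))⟩
    · exact ⟨δ, fun r x y hxy i => (abs_coord_le_sqrt_sum
        (fun i => min |((x i : ℕ) : ℝ) - ((y i : ℕ) : ℝ)|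
        ((r : ℝ) + 1 - |((x i : ℕ) : ℝ) - ((y i : ℕ) : ℝ)|)) i).trans (h r x y hxy)⟩
  refine ⟨(4 * ⌈δ⌉₊ + 1) ^ d, fun r v => ?_⟩
  rw [← SimpleGraph.card_neighborFinset_eq_degree]
  have hsub : (G r).neighborFinset v ⊆ Fintype.piFinset fun i => Finset.univ.filter
      fun b : Fin (r + 1) => min |((v i : ℕ) : ℝ) - ((b : ℕ) : ℝ)|
        ((r : ℝ) + 1 - |((v i : ℕ) : ℝ) - ((b : ℕ) : ℝ)|) ≤ (⌈δ⌉₊ : ℕ) := by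
    intro y hy
    rw [SimpleGraph.mem_neighborFinset] at hy
    simp only [Fintype.mem_piFinset, Finset.mem_filter, Finset.mem_univ, true_and]
    exact fun i => (hδ r v y hy i).trans (Nat.le_ceil δ)
  refine (Finset.card_le_card hsub).trans ?_
  rw [Fintype.card_piFinset]
  refine (Finset.prod_le_pow_card _ _ _ fun i _ => card_filter_circle_le r _ (v i)).trans ?_
  simp

open Classical in
theorem avgDegree_le_of_degree_le {V : Type*} [Fintype V] (H : SimpleGraph V) {C : ℝ}
    (hC : 0 ≤ C) (h : ∀ v, (H.degree v : ℝ) ≤ C) : avgDegree H ≤ C := by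
  unfold avgDegree
  refine div_le_of_le_mul₀ (by positivity) hC ?_
  refine (Finset.sum_le_sum fun v _ => h v).trans ?_
  simp [mul_comm]

open Classical in
theorem lapForm_le_of_degree_le {V : Type*} [Fintype V] (H : SimpleGraph V) {C : ℝ}
    (h : ∀ v, (H.degree v : ℝ) ≤ C) (x : V → ℝ) : lapForm H x ≤ 2 * C * ∑ i, x i ^ 2 := by
  have h1 : ∀ i j, (if H.Adj i j then (x i - x j) ^ 2 else 0) ≤
      2 * x i ^ 2 * (if H.Adj i j then 1 else 0) + 2 * x j ^ 2 * (if H.Adj j i then 1 else 0) := by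
    intro i j
    rw [H.adj_comm j i]
    split_ifs
    · nlinarith [sq_nonneg (x i + x j)]
    · simp
  have h2 : ∀ i, ∑ j, 2 * x i ^ 2 * (if H.Adj i j then (1 : ℝ) else 0) ≤ 2 * C * x i ^ 2 := by
    intro i
    rw [← Finset.mul_sum, ← SimpleGraph.degree_eq_sum_if_adj]
    nlinarith [mul_le_mul_of_nonneg_right (h i) (sq_nonneg (x i))]
  have h3 : (∑ i, ∑ j, if H.Adj i j then (x i - x j) ^ 2 else 0) ≤
      2 * C * ∑ i, x i ^ 2 + 2 * C * ∑ i, x i ^ 2 := by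
    refine (Finset.sum_le_sum fun i _ => Finset.sum_le_sum fun j _ => h1 i j).trans ?_
    simp only [Finset.sum_add_distrib]
    rw [Finset.sum_comm (f := fun i j => 2 * x j ^ 2 * (if H.Adj j i then (1 : ℝ) else 0)),
      Finset.mul_sum]
    exact add_le_add (Finset.sum_le_sum fun i _ => h2 i) (Finset.sum_le_sum fun i _ => h2 i)
  unfold lapForm
  linarith

theorem lapForm_mono {V : Type*} [Fintype V] {H K : SimpleGraph V} (h : H ≤ K) (x : V → ℝ) :
    lapForm H x ≤ lapForm K x := by
  classical
  unfold lapForm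
  gcongr with i _ j _
  split_ifs with h1 h2
  · exact le_rfl
  · exact absurd (h h1) h2
  · positivity
  · exact le_rfl

theorem lapForm_sup_le {V : Type*} [Fintype V] (H K : SimpleGraph V) (x : V → ℝ) :
    lapForm (H ⊔ K) x ≤ lapForm H x + lapForm K x := by
  classical
  unfold lapForm
  rw [← add_div]
  simp only [← Finset.sum_add_distrib]
  gcongr with i _ j _
  have := sq_nonneg (x i - x j)
  rw [SimpleGraph.sup_adj]
  split_ifs <;> first | linarith | tauto

theorem card_lattice (d r : ℕ) : Fintype.card (Lattice d r) = (r + 1) ^ d := by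
  simp [Lattice]

theorem tendsto_card_lattice {d : ℕ} (hd : 1 ≤ d) :
    Tendsto (fun r => Fintype.card (Lattice d r)) atTop atTop := by
  simp only [card_lattice]
  refine tendsto_atTop_mono (fun r => ?_) tendsto_id
  calc r ≤ r + 1 := by omega
    _ ≤ (r + 1) ^ d := Nat.le_self_pow (by omega) _

/-! ### Hoeffding's inequality for the edges of `G(n, s)`. -/

section

instance instMeasurableSingletonClassSimpleGraph {V : Type*} [Finite V] :
    MeasurableSingletonClass (SimpleGraph V) where
  measurableSet_singleton H := by
    have : MeasurableSet ({H.edgeSet} : Set (Set (Sym2 V))) := measurableSet_singleton _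
    have h := SimpleGraph.measurable_edgeSet (V := V) this
    convert h using 1
    ext K
    simp

/-- Exponential moment of a centered Bernoulli variable. -/
theorem bernoulli_mgf_le {s : ℝ} (h0 : 0 ≤ s) (h1 : s ≤ 1) (l : ℝ) :
    s * Real.exp (l * (1 - s)) + (1 - s) * Real.exp (l * (0 - s)) ≤ Real.exp (l ^ 2 / 2) := by
  set A := s * Real.exp (l * (1 - s)) + (1 - s) * Real.exp (l * (0 - s)) with hA
  -- Symmetrisation: `B` is the moment of the negated variable, at least `1` by convexity, and `A *
  -- B` is the moment of the difference of two independent copies, an average of `1` and `cosh l`.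
  set B := s * Real.exp (-(l * (1 - s))) + (1 - s) * Real.exp (-(l * (0 - s))) with hB
  have h1s : 0 ≤ 1 - s := by linarith
  have hA0 : 0 ≤ A := by positivity
  have hB1 : 1 ≤ B := by
    have e1 := mul_le_mul_of_nonneg_left (Real.add_one_le_exp (-(l * (1 - s)))) h0
    have e2 := mul_le_mul_of_nonneg_left (Real.add_one_le_exp (-(l * (0 - s)))) h1s
    rw [hB]
    nlinarith
  have hAB : A * B = s ^ 2 + (1 - s) ^ 2 + 2 * (s * (1 - s)) * Real.cosh l := by
    have e1 : Real.exp (l * (1 - s)) * Real.exp (-(l * (1 - s))) = 1 := by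
      rw [← Real.exp_add]; simp
    have e2 : Real.exp (l * (0 - s)) * Real.exp (-(l * (0 - s))) = 1 := by
      rw [← Real.exp_add]; simp
    have e3 : Real.exp (l * (1 - s)) * Real.exp (-(l * (0 - s))) = Real.exp l := by
      rw [← Real.exp_add]; ring_nf
    have e4 : Real.exp (l * (0 - s)) * Real.exp (-(l * (1 - s))) = Real.exp (-l) := by
      rw [← Real.exp_add]; ring_nf
    rw [hA, hB, Real.cosh_eq]
    linear_combination s ^ 2 * e1 + (1 - s) ^ 2 * e2 + s * (1 - s) * e3 + s * (1 - s) * e4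
  have hcosh := Real.one_le_cosh l
  have hs : s * (1 - s) ≤ 1 / 4 := by nlinarith [sq_nonneg (s - 1 / 2)]
  calc A ≤ A * B := le_mul_of_one_le_right hA0 hB1
    _ ≤ Real.cosh l := by rw [hAB]; nlinarith
    _ ≤ Real.exp (l ^ 2 / 2) := Real.cosh_le_exp_half_sq l

variable {V : Type*} [Fintype V]

open Classical in
theorem binomialRandom_real_singleton (s : unitInterval) (H : SimpleGraph V) :
    (SimpleGraph.binomialRandom V s).real {H} = (s : ℝ) ^ H.edgeFinset.card *
      (1 - (s : ℝ)) ^ ((⊤ : SimpleGraph V).edgeFinset \ H.edgeFinset).card := by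
  rw [Measure.real, SimpleGraph.binomialRandom_singleton,
    Finset.card_sdiff_of_subset (SimpleGraph.edgeFinset_mono le_top),
    SimpleGraph.card_edgeFinset_top_eq_card_choose_two, Nat.card_eq_fintype_card,
    ← SimpleGraph.coe_edgeFinset, Set.ncard_coe_finset]
  simp [ENNReal.toReal_mul, ENNReal.toReal_pow]

open Classical in
/-- Independence of the edges: expectations of products over edges factor. -/
theorem sum_binomialRandom_mul_prod (s : unitInterval) (g h : Sym2 V → ℝ) :
    ∑ H : SimpleGraph V, (SimpleGraph.binomialRandom V s).real {H} *
      ∏ e ∈ (⊤ : SimpleGraph V).edgeFinset, (if e ∈ H.edgeSet then g e else h e) =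
    ∏ e ∈ (⊤ : SimpleGraph V).edgeFinset, ((s : ℝ) * g e + (1 - (s : ℝ)) * h e) := by
  rw [Finset.prod_add]
  refine Finset.sum_bij' (fun H _ => H.edgeFinset)
    (fun t _ => SimpleGraph.fromEdgeSet (t : Set (Sym2 V))) ?_ ?_ ?_ ?_ ?_
  · intro H _
    exact Finset.mem_powerset.2 (SimpleGraph.edgeFinset_mono le_top)
  · simp
  · intro H _
    simp
  · intro t ht
    rw [Finset.mem_powerset] at ht
    ext e
    have hmem : e ∈ (SimpleGraph.fromEdgeSet (t : Set (Sym2 V))).edgeSet ↔ e ∈ t ∧ ¬ e.IsDiag := by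
      rw [SimpleGraph.edgeSet_fromEdgeSet]
      exact Iff.rfl
    generalize SimpleGraph.fromEdgeSet (t : Set (Sym2 V)) = H at hmem ⊢
    rw [SimpleGraph.mem_edgeFinset, hmem]
    constructor
    · exact fun h => h.1
    · intro h
      refine ⟨h, ?_⟩
      have := SimpleGraph.mem_edgeFinset.1 (ht h)
      rwa [SimpleGraph.edgeSet_top] at this
  · intro H _
    rw [binomialRandom_real_singleton, Finset.prod_mul_distrib, Finset.prod_mul_distrib,
      Finset.prod_const, Finset.prod_const]
    have hsub : H.edgeFinset ⊆ (⊤ : SimpleGraph V).edgeFinset := SimpleGraph.edgeFinset_mono le_top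
    rw [← Finset.prod_sdiff hsub]
    have e1 : ∏ e ∈ H.edgeFinset, (if e ∈ H.edgeSet then g e else h e) =
        ∏ e ∈ H.edgeFinset, g e :=
      Finset.prod_congr rfl fun e he => if_pos (SimpleGraph.mem_edgeFinset.1 he)
    have e2 : ∏ e ∈ (⊤ : SimpleGraph V).edgeFinset \ H.edgeFinset,
        (if e ∈ H.edgeSet then g e else h e) =
        ∏ e ∈ (⊤ : SimpleGraph V).edgeFinset \ H.edgeFinset, h e :=
      Finset.prod_congr rfl fun e he => if_neg fun h' =>
        (Finset.mem_sdiff.1 he).2 (SimpleGraph.mem_edgeFinset.2 h')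
    rw [e1, e2]
    ring

open Classical in
theorem sum_ne_eq_sum_edgeFinset_top (f : V → V → ℝ) (F : Sym2 V → ℝ)
    (hF : ∀ i j, f i j = F s(i, j)) :
    (∑ i, ∑ j, if i ≠ j then f i j else 0) =
      ∑ e ∈ (⊤ : SimpleGraph V).edgeFinset, 2 * F e := by
  have h1 : (∑ i, ∑ j, if i ≠ j then f i j else 0) =
      ∑ q ∈ (Finset.univ : Finset V).offDiag, F s(q.1, q.2) := by
    have hoff : (Finset.univ : Finset V).offDiag =
        (Finset.univ ×ˢ Finset.univ).filter fun q => q.1 ≠ q.2 := by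
      ext
      simp
    rw [← Finset.sum_product', hoff, Finset.sum_filter]
    exact Finset.sum_congr rfl fun q _ => by rw [hF]
  rw [h1, ← Finset.sum_fiberwise_of_maps_to (t := (⊤ : SimpleGraph V).edgeFinset)
    (g := fun q : V × V => s(q.1, q.2))]
  · refine Finset.sum_congr rfl fun e he => ?_
    induction e with
    | _ a b =>
      have hab : a ≠ b := by simpa using he
      have : ((Finset.univ : Finset V).offDiag.filter fun q : V × V => s(q.1, q.2) = s(a, b)) =
          {(a, b), (b, a)} := by
        ext ⟨x, y⟩
        simp only [Finset.mem_filter, Finset.mem_offDiag, Finset.mem_univ, true_and,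
          Finset.mem_insert, Finset.mem_singleton, Prod.mk.injEq, Sym2.eq_iff]
        constructor
        · exact fun h => h.2
        · rintro (⟨rfl, rfl⟩ | ⟨rfl, rfl⟩)
          · exact ⟨hab, Or.inl ⟨rfl, rfl⟩⟩
          · exact ⟨hab.symm, Or.inr ⟨rfl, rfl⟩⟩
      rw [this, Finset.sum_pair (by simp [hab]), Sym2.eq_swap (a := b)]
      ring
  · intro q hq
    simpa using hq

open Classical in
/-- The sum of `f i j` times the centered edge indicator of `i j`, over ordered pairs. -/
noncomputable def centeredSum (H : SimpleGraph V) (s : ℝ) (f : V → V → ℝ) : ℝ :=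
  ∑ i, ∑ j, if i ≠ j then f i j * ((if H.Adj i j then 1 else 0) - s) else 0

open Classical in
/-- Hoeffding's inequality for linear functionals of the edge indicators of `G(n, s)`. -/
theorem binomialRandom_real_le_centeredSum (s : unitInterval) {f : V → V → ℝ}
    (hf : ∀ i j, f i j = f j i) {K : ℝ} (hK : 0 < K) (hfK : ∑ i, ∑ j, f i j ^ 2 ≤ K) {t : ℝ}
    (ht : 0 ≤ t) :
    (SimpleGraph.binomialRandom V s).real {H | t ≤ centeredSum H s f} ≤
      Real.exp (-(t ^ 2 / (4 * K))) := by
  let F : Sym2 V → ℝ := Sym2.lift ⟨f, hf⟩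
  have hF : ∀ i j, f i j = F s(i, j) := fun i j => rfl
  set U := (⊤ : SimpleGraph V).edgeFinset with hU
  have hX : ∀ H : SimpleGraph V, centeredSum H s f =
      ∑ e ∈ U, 2 * (F e * ((if e ∈ H.edgeSet then 1 else 0) - s)) := by
    intro H
    unfold centeredSum
    exact sum_ne_eq_sum_edgeFinset_top _ _ fun i j => by
      rw [hF]; simp only [SimpleGraph.mem_edgeSet]
  have hsq : ∑ e ∈ U, 2 * F e ^ 2 ≤ K := by
    rw [← sum_ne_eq_sum_edgeFinset_top (fun i j => f i j ^ 2) (fun e => F e ^ 2)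
      (fun i j => by rw [hF])]
    refine le_trans ?_ hfK
    gcongr with i _ j _
    split_ifs
    · exact le_rfl
    · positivity
  -- Minimiser of the final exponent `-(l * t) + l ^ 2 * K`.
  let l : ℝ := t / (2 * K)
  have hl : 0 ≤ l := by positivity
  set μ := SimpleGraph.binomialRandom V s
  calc μ.real {H | t ≤ centeredSum H s f}
      = ∑ H ∈ Finset.univ.filter (fun H => t ≤ centeredSum H s f), μ.real {H} := by
        rw [sum_measureReal_singleton]; simp
    _ ≤ ∑ H ∈ Finset.univ.filter (fun H => t ≤ centeredSum H s f),
          μ.real {H} * Real.exp (l * (centeredSum H s f - t)) := by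
        refine Finset.sum_le_sum fun H hH => le_mul_of_one_le_right measureReal_nonneg ?_
        have := (Finset.mem_filter.1 hH).2
        exact Real.one_le_exp (mul_nonneg hl (by linarith))
    _ ≤ ∑ H, μ.real {H} * Real.exp (l * (centeredSum H s f - t)) :=
        Finset.sum_le_sum_of_subset_of_nonneg (Finset.filter_subset _ _) fun H _ _ => by positivity
    _ = Real.exp (-(l * t)) * ∑ H : SimpleGraph V, μ.real {H} * ∏ e ∈ U,
          (if e ∈ H.edgeSet then Real.exp ((2 * l * F e) * (1 - s))
            else Real.exp ((2 * l * F e) * (0 - s))) := by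
        rw [Finset.mul_sum]
        refine Finset.sum_congr rfl fun H _ => ?_
        rw [hX, mul_left_comm, ← Finset.prod_congr rfl fun e _ => apply_ite Real.exp _ _ _,
          ← Real.exp_sum, ← Real.exp_add]
        congr 2
        rw [mul_sub, Finset.mul_sum, sub_eq_neg_add]
        congr 1
        refine Finset.sum_congr rfl fun e _ => ?_
        split_ifs <;> ring
    _ = Real.exp (-(l * t)) * ∏ e ∈ U, ((s : ℝ) * Real.exp ((2 * l * F e) * (1 - s)) +
          (1 - (s : ℝ)) * Real.exp ((2 * l * F e) * (0 - s))) := by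
        rw [sum_binomialRandom_mul_prod s (fun e => Real.exp ((2 * l * F e) * (1 - s)))
          (fun e => Real.exp ((2 * l * F e) * (0 - s)))]
    _ ≤ Real.exp (-(l * t)) * ∏ e ∈ U, Real.exp ((2 * l * F e) ^ 2 / 2) := by
        refine mul_le_mul_of_nonneg_left (Finset.prod_le_prod (fun e _ => ?_) fun e _ =>
          bernoulli_mgf_le s.2.1 s.2.2 _) (Real.exp_nonneg _)
        have := s.2.1
        have : 0 ≤ 1 - (s : ℝ) := by linarith [s.2.2]
        positivity
    _ = Real.exp (-(l * t) + l ^ 2 * ∑ e ∈ U, 2 * F e ^ 2) := by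
        rw [← Real.exp_sum, ← Real.exp_add, Finset.mul_sum]
        congr 2
        exact Finset.sum_congr rfl fun e _ => by ring
    _ ≤ Real.exp (-(t ^ 2 / (4 * K))) := by
        apply Real.exp_le_exp.2
        have h1 : l ^ 2 * ∑ e ∈ U, 2 * F e ^ 2 ≤ l ^ 2 * K := by gcongr
        have h2 : -(l * t) + l ^ 2 * K = -(t ^ 2 / (4 * K)) := by
          simp only [l]
          field_simp
          ring
        linarith

end

/-! ### Concentration of degrees, quadratic form and edge count. -/

section

variable {V : Type*} [Fintype V]

theorem centeredSum_neg (H : SimpleGraph V) (s : ℝ) (f : V → V → ℝ) :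
    centeredSum H s (fun i j => -f i j) = -centeredSum H s f := by
  unfold centeredSum
  rw [← Finset.sum_neg_distrib]
  refine Finset.sum_congr rfl fun i _ => ?_
  rw [← Finset.sum_neg_distrib]
  exact Finset.sum_congr rfl fun j _ => by split_ifs <;> ring

theorem binomialRandom_real_le_abs_centeredSum (s : unitInterval) {f : V → V → ℝ}
    (hf : ∀ i j, f i j = f j i) {K : ℝ} (hK : 0 < K) (hfK : ∑ i, ∑ j, f i j ^ 2 ≤ K) {t : ℝ}
    (ht : 0 ≤ t) :
    (SimpleGraph.binomialRandom V s).real {H | t ≤ |centeredSum H s f|} ≤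
      2 * Real.exp (-(t ^ 2 / (4 * K))) := by
  have h1 := binomialRandom_real_le_centeredSum s hf hK hfK ht
  have h2 := binomialRandom_real_le_centeredSum s (f := fun i j => -f i j)
    (fun i j => by rw [hf]) hK (by simpa using hfK) ht
  have hsub : {H : SimpleGraph V | t ≤ |centeredSum H s f|} ⊆
      {H | t ≤ centeredSum H s f} ∪ {H | t ≤ centeredSum H s fun i j => -f i j} := by
    intro H hH
    simpa [centeredSum_neg, le_abs] using hH
  refine (measureReal_mono hsub).trans ((measureReal_union_le _ _).trans ?_)
  linarith

open Classical in
theorem sum_ne_adj_eq_degree (H : SimpleGraph V) (s : ℝ) (v : V) :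
    (∑ j, if v ≠ j then ((if H.Adj v j then (1 : ℝ) else 0) - s) else 0) =
      H.degree v - s * (Fintype.card V - 1) := by
  have h : ∀ j, (if v ≠ j then ((if H.Adj v j then (1 : ℝ) else 0) - s) else 0) =
      (if H.Adj v j then (1 : ℝ) else 0) - s + (if v = j then s else 0) := by
    intro j
    by_cases hj : v = j
    · simp [hj]
    · simp [hj]
  simp only [h, Finset.sum_add_distrib, Finset.sum_sub_distrib]
  rw [← SimpleGraph.degree_eq_sum_if_adj]
  simp
  ring

open Classical in
theorem centeredSum_one (H : SimpleGraph V) (s : ℝ) :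
    centeredSum H s (fun _ _ => 1) =
      2 * H.edgeSet.ncard - s * Fintype.card V * (Fintype.card V - 1) := by
  unfold centeredSum
  simp only [one_mul]
  rw [Finset.sum_congr rfl fun i _ => sum_ne_adj_eq_degree H s i, Finset.sum_sub_distrib,
    sum_degree_eq_two_mul_ncard]
  simp
  ring

open Classical in
-- Makes a degree deviation a centered sum, so that the tail bound applies. That bound needs
-- symmetric weights, so the edges at `v` are weighted in both orders, whence the factor `2`.
theorem centeredSum_star (H : SimpleGraph V) (s : ℝ) (v : V) :
    centeredSum H s (fun i j => (if i = v then 1 else 0) + (if j = v then 1 else 0)) =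
      2 * (H.degree v - s * (Fintype.card V - 1)) := by
  set B : V → V → ℝ := fun i j => if i ≠ j then ((if H.Adj i j then (1 : ℝ) else 0) - s) else 0
    with hB
  have hBs : ∀ i j, B i j = B j i := fun i j => by simp only [hB, H.adj_comm i j, ne_comm]
  have h : centeredSum H s (fun i j => (if i = v then 1 else 0) + (if j = v then 1 else 0)) =
      ∑ i, ∑ j, ((if i = v then B i j else 0) + (if j = v then B i j else 0)) := by
    unfold centeredSum
    refine Finset.sum_congr rfl fun i _ => Finset.sum_congr rfl fun j _ => ?_
    simp only [hB]
    split_ifs <;> ring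
  rw [h, ← sum_ne_adj_eq_degree H s v]
  simp only [Finset.sum_add_distrib]
  rw [Finset.sum_comm]
  simp only [Finset.sum_ite_eq', Finset.mem_univ, if_true]
  rw [Finset.sum_congr rfl fun i _ => hBs i v]
  simp only [hB]
  ring

theorem abs_centeredSum_sub_le (H : SimpleGraph V) {s : ℝ} (h0 : 0 ≤ s) (h1 : s ≤ 1)
    (f g : V → V → ℝ) :
    |centeredSum H s f - centeredSum H s g| ≤ ∑ i, ∑ j, |f i j - g i j| := by
  classical
  unfold centeredSum
  rw [← Finset.sum_sub_distrib]
  refine (Finset.abs_sum_le_sum_abs _ _).trans (Finset.sum_le_sum fun i _ => ?_)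
  rw [← Finset.sum_sub_distrib]
  refine (Finset.abs_sum_le_sum_abs _ _).trans (Finset.sum_le_sum fun j _ => ?_)
  split_ifs
  · rw [← sub_mul, abs_mul]
    refine mul_le_of_le_one_right (abs_nonneg _) (abs_le.2 ⟨by linarith, by linarith⟩)
  · rw [← sub_mul, abs_mul]
    refine mul_le_of_le_one_right (abs_nonneg _) (abs_le.2 ⟨by linarith, by linarith⟩)
  · simp

theorem sum_abs_le_sqrt_card (x : V → ℝ) (hx : ∑ i, x i ^ 2 ≤ 1) :
    ∑ i, |x i| ≤ Real.sqrt (Fintype.card V) := by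
  refine Real.le_sqrt_of_sq_le ?_
  refine (sq_sum_le_card_mul_sum_sq (s := Finset.univ) (f := fun i => |x i|)).trans ?_
  simp only [sq_abs, Finset.card_univ]
  exact mul_le_of_le_one_right (by positivity) hx

/-- Rounding the coordinates to multiples of `1 / n` changes the centered quadratic form of a unit
vector by at most `3 √n`. -/
theorem abs_centeredSum_round_sub_le (H : SimpleGraph V) {s : ℝ} (h0 : 0 ≤ s) (h1 : s ≤ 1)
    (hV : 1 ≤ Fintype.card V) {x y : V → ℝ} (hx : ∑ i, x i ^ 2 ≤ 1)
    (hxy : ∀ i, |x i - y i| ≤ 1 / Fintype.card V) :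
    |centeredSum H s (fun i j => x i * x j) - centeredSum H s (fun i j => y i * y j)| ≤
      3 * Real.sqrt (Fintype.card V) := by
  have hn : (1 : ℝ) ≤ Fintype.card V := by exact_mod_cast hV
  have hsx := sum_abs_le_sqrt_card x hx
  have hsqrt : 1 ≤ Real.sqrt (Fintype.card V) := Real.one_le_sqrt.2 hn
  have hsxy : ∑ i, |x i - y i| ≤ 1 := by
    refine (Finset.sum_le_sum fun i _ => hxy i).trans ?_
    simp only [Finset.sum_const, Finset.card_univ, nsmul_eq_mul]
    rw [mul_one_div_cancel (by linarith)]
  have hsy : ∑ i, |y i| ≤ Real.sqrt (Fintype.card V) + 1 := by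
    refine le_trans ?_ (add_le_add hsx hsxy)
    rw [← Finset.sum_add_distrib]
    refine Finset.sum_le_sum fun i _ => ?_
    have := abs_sub_abs_le_abs_sub (y i) (x i)
    rw [abs_sub_comm] at this
    linarith
  refine (abs_centeredSum_sub_le H h0 h1 _ _).trans ?_
  have hterm : ∀ i j, |x i * x j - y i * y j| ≤ |x i - y i| * |x j| + |y i| * |x j - y j| := by
    intro i j
    rw [← abs_mul, ← abs_mul]
    refine le_trans (le_of_eq ?_) (abs_add_le _ _)
    congr 1
    ring
  refine (Finset.sum_le_sum fun i _ => Finset.sum_le_sum fun j _ => hterm i j).trans ?_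
  simp only [Finset.sum_add_distrib, ← Finset.mul_sum, ← Finset.sum_mul]
  have hx0 : 0 ≤ ∑ i, |x i| := by positivity
  have hy0 : 0 ≤ ∑ i, |y i| := by positivity
  have e1 := mul_le_mul_of_nonneg_right hsxy hx0
  have e2 := mul_le_mul_of_nonneg_left hsxy hy0
  linarith

open Classical in
/-- Degrees, quadratic form and number of edges of `H` are as in a typical graph with edge density
`s`, up to an error governed by `t`. -/
structure Concentrated (H : SimpleGraph V) (s t : ℝ) : Prop where
  degree : ∀ v, |(H.degree v : ℝ) - s * (Fintype.card V - 1)| ≤ t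
  form : ∀ x : V → ℝ, |centeredSum H s fun i j => x i * x j| ≤ t * ∑ i, x i ^ 2
  edges : 2 * (H.edgeSet.ncard : ℝ) ≤
    s * Fintype.card V * (Fintype.card V - 1) + Real.sqrt (Fintype.card V) * t

theorem centeredSum_smul (H : SimpleGraph V) (s c : ℝ) (f : V → V → ℝ) :
    centeredSum H s (fun i j => c * f i j) = c * centeredSum H s f := by
  unfold centeredSum
  simp only [Finset.mul_sum]
  refine Finset.sum_congr rfl fun i _ => Finset.sum_congr rfl fun j _ => ?_
  split_ifs <;> ring

theorem abs_centeredSum_le_of_unit {H : SimpleGraph V} {s t : ℝ}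
    (h : ∀ x : V → ℝ, ∑ i, x i ^ 2 = 1 → |centeredSum H s fun i j => x i * x j| ≤ t)
    (x : V → ℝ) : |centeredSum H s fun i j => x i * x j| ≤ t * ∑ i, x i ^ 2 := by
  set c := ∑ i, x i ^ 2 with hc
  have hc0 : 0 ≤ c := by positivity
  rcases hc0.eq_or_lt with hc0 | hc0
  · have hx : ∀ i, x i = 0 := by
      intro i
      have := (Finset.sum_eq_zero_iff_of_nonneg (fun i _ => sq_nonneg (x i))).1 hc0.symm i
        (Finset.mem_univ i)
      simpa using this
    simp [hx, centeredSum, ← hc0]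
  · have hr : 0 < Real.sqrt c := Real.sqrt_pos.2 hc0
    have hrr : Real.sqrt c ^ 2 = c := Real.sq_sqrt hc0.le
    have h1 := h (fun i => x i / Real.sqrt c) (by
      simp only [div_pow, hrr, ← Finset.sum_div]
      rw [← hc, div_self hc0.ne'])
    have h2 : (fun i j => x i * x j) =
        fun i j => c * (x i / Real.sqrt c * (x j / Real.sqrt c)) := by
      ext i j
      rw [div_mul_div_comm, ← sq, hrr, mul_div_cancel₀ _ hc0.ne']
    rw [h2, centeredSum_smul, abs_mul, abs_of_pos hc0, mul_comm]
    exact mul_le_mul_of_nonneg_right h1 hc0.le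

/-- Integer vectors with entries bounded by `n` that, divided by `n`, have norm at most `2`. -/
noncomputable def gridNet (V : Type*) [Fintype V] : Finset (V → ℤ) := by
  classical
  exact (Fintype.piFinset fun _ : V => Finset.Icc (-(Fintype.card V : ℤ)) (Fintype.card V)).filter
    fun z => ∑ i, ((z i : ℝ) / Fintype.card V) ^ 2 ≤ 4

/-- The norm condition is ignored in the count: `n log (2 n + 1)` is still negligible against `t ^ 2
= n ^ (1 + 2 k)`. -/
theorem card_gridNet_le (V : Type*) [Fintype V] :
    (gridNet V).card ≤ (2 * Fintype.card V + 1) ^ Fintype.card V := by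
  classical
  unfold gridNet
  refine (Finset.card_filter_le _ _).trans ?_
  rw [Fintype.card_piFinset, Finset.prod_const, Finset.card_univ, Int.card_Icc]
  refine Nat.pow_le_pow_left ?_ _
  omega

theorem exists_mem_gridNet (hV : 1 ≤ Fintype.card V) {x : V → ℝ} (hx : ∑ i, x i ^ 2 = 1) :
    ∃ z ∈ gridNet V, ∀ i, |x i - (z i : ℝ) / Fintype.card V| ≤ 1 / Fintype.card V := by
  classical
  set n : ℝ := ((Fintype.card V : ℕ) : ℝ) with hn
  have hn1 : 1 ≤ n := by rw [hn]; exact_mod_cast hV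
  have hn0 : 0 < n := by linarith
  have hround : ∀ i, |x i - (⌊n * x i⌋ : ℝ) / n| ≤ 1 / n := by
    intro i
    have e : x i - (⌊n * x i⌋ : ℝ) / n = (n * x i - ⌊n * x i⌋) / n := by field_simp
    rw [e, abs_div, abs_of_pos hn0]
    gcongr
    have h1 := Int.floor_le (n * x i)
    have h2 := Int.lt_floor_add_one (n * x i)
    exact abs_le.2 ⟨by linarith, by linarith⟩
  refine ⟨fun i => ⌊n * x i⌋, ?_, hround⟩
  unfold gridNet
  rw [Finset.mem_filter, Fintype.mem_piFinset]
  constructor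
  · intro i
    have hxi : x i ^ 2 ≤ 1 := by
      rw [← hx]
      exact Finset.single_le_sum (f := fun j => x j ^ 2) (fun j _ => sq_nonneg _)
        (Finset.mem_univ i)
    have habs := abs_le.1 ((sq_le_one_iff_abs_le_one _).1 hxi)
    rw [Finset.mem_Icc]
    constructor
    · refine Int.le_floor.2 ?_
      push_cast
      rw [← hn]
      nlinarith
    · have : (⌊n * x i⌋ : ℝ) ≤ Fintype.card V := by
        refine (Int.floor_le _).trans ?_
        rw [← hn]
        nlinarith
      exact_mod_cast this
  · rw [← hn]
    -- From `a² ≤ 2 x² + 2 (x - a)²` and `(1 / n)² ≤ 1 / n`; summing over the `n` coordinates gives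
    -- `2 + 2 = 4`.
    have hterm : ∀ i, ((⌊n * x i⌋ : ℝ) / n) ^ 2 ≤ 2 * x i ^ 2 + 2 * (1 / n) := by
      intro i
      have h1 := sq_le_sq' (abs_le.1 (hround i)).1 (abs_le.1 (hround i)).2
      have h2 : (1 / n) ^ 2 ≤ 1 / n := by
        have : 1 / n ≤ 1 := by rw [div_le_one hn0]; exact hn1
        have h0 : 0 ≤ 1 / n := by positivity
        nlinarith
      nlinarith [sq_nonneg (2 * x i - (⌊n * x i⌋ : ℝ) / n)]
    refine (Finset.sum_le_sum fun i _ => hterm i).trans ?_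
    rw [Finset.sum_add_distrib, ← Finset.mul_sum, hx]
    simp only [Finset.sum_const, Finset.card_univ, nsmul_eq_mul]
    rw [← hn]
    field_simp
    norm_num

open Classical in
-- Union bound over the stars, the total edge count and the net. The assumption on `t` makes the
-- rounding error `3 √n` at most `t / 2`, so failure of the form at a unit vector shows at a net
-- point with threshold `t / 2`. There the squared weights sum to at most `16`, hence the exponent
-- `(t / 2)² / (4 · 16) = t² / 256`.
theorem binomialRandom_real_not_concentrated_le (hV : 1 ≤ Fintype.card V) (s : unitInterval)
    {t : ℝ} (ht : 6 * Real.sqrt (Fintype.card V) ≤ t) :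
    (SimpleGraph.binomialRandom V s).real {H | ¬ Concentrated H s t} ≤
      (2 * Fintype.card V + 1) * Real.exp (-(t ^ 2 / (16 * Fintype.card V))) +
      2 * (2 * Fintype.card V + 1) ^ Fintype.card V * Real.exp (-(t ^ 2 / 256)) := by
  set n : ℝ := ((Fintype.card V : ℕ) : ℝ) with hn
  set μ := SimpleGraph.binomialRandom V s
  have hn1 : 1 ≤ n := by rw [hn]; exact_mod_cast hV
  have hn0 : 0 < n := by linarith
  have ht0 : 0 ≤ t := le_trans (by positivity) ht
  let star : V → V → V → ℝ := fun v i j => (if i = v then 1 else 0) + (if j = v then 1 else 0)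
  let quad : (V → ℤ) → V → V → ℝ := fun z i j => ((z i : ℝ) / n) * ((z j : ℝ) / n)
  have hsub : {H : SimpleGraph V | ¬ Concentrated H s t} ⊆
      ((⋃ v ∈ (Finset.univ : Finset V), {H | 2 * t ≤ |centeredSum H s (star v)|}) ∪
        {H | Real.sqrt n * t ≤ centeredSum H s fun _ _ => 1}) ∪
      ⋃ z ∈ gridNet V, {H | t / 2 ≤ |centeredSum H s (quad z)|} := by
    intro H hH
    by_contra hcon
    simp only [Set.mem_union, Set.mem_iUnion, Set.mem_ofPred_eq, not_or, not_exists,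
      not_le] at hcon
    obtain ⟨⟨hA, hB⟩, hC⟩ := hcon
    refine hH ⟨fun v => ?_, abs_centeredSum_le_of_unit fun x hx => ?_, ?_⟩
    · have h := hA v (Finset.mem_univ v)
      rw [centeredSum_star, abs_mul, abs_two] at h
      linarith
    · obtain ⟨z, hz, hxz⟩ := exists_mem_gridNet hV hx
      have h1 := hC z hz
      have h2 := abs_centeredSum_round_sub_le H s.2.1 s.2.2 hV hx.le hxz
      have h3 := abs_sub_abs_le_abs_sub (centeredSum H s fun i j => x i * x j)
        (centeredSum H s (quad z))
      have h4 : |(centeredSum H s fun i j => x i * x j) - centeredSum H s (quad z)| ≤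
        3 * Real.sqrt n := h2
      linarith
    · rw [centeredSum_one] at hB
      rw [← hn] at hB ⊢
      linarith
  have hA : ∀ v ∈ (Finset.univ : Finset V), μ.real {H | 2 * t ≤ |centeredSum H s (star v)|} ≤
      2 * Real.exp (-(t ^ 2 / (16 * n))) := by
    intro v _
    have hK : ∑ i, ∑ j, star v i j ^ 2 ≤ 4 * n := by
      have : ∀ i j, star v i j ^ 2 ≤ (if i = v then 2 else 0) + (if j = v then 2 else 0) := by
        intro i j
        simp only [star]
        split_ifs <;> norm_num
      refine (Finset.sum_le_sum fun i _ => Finset.sum_le_sum fun j _ => this i j).trans ?_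
      simp only [Finset.sum_add_distrib, Finset.sum_const, Finset.sum_ite_eq', Finset.mem_univ,
        if_true, Finset.card_univ, nsmul_eq_mul, ← Finset.mul_sum]
      rw [← hn]
      linarith
    refine (binomialRandom_real_le_abs_centeredSum s (fun i j => add_comm _ _) (by positivity) hK
      (by positivity)).trans ?_
    refine mul_le_mul_of_nonneg_left (Real.exp_le_exp.2 (neg_le_neg ?_)) (by norm_num)
    rw [div_le_div_iff₀ (by positivity) (by positivity)]
    nlinarith [mul_nonneg (sq_nonneg t) hn0.le]
  have hB : μ.real {H | Real.sqrt n * t ≤ centeredSum H s fun _ _ => 1} ≤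
      Real.exp (-(t ^ 2 / (16 * n))) := by
    refine (binomialRandom_real_le_centeredSum s (f := fun _ _ => 1) (fun _ _ => rfl) (K := n ^ 2)
      (by positivity) (by simp [sq, hn]) (by positivity)).trans ?_
    refine Real.exp_le_exp.2 (neg_le_neg ?_)
    rw [div_le_div_iff₀ (by positivity) (by positivity), mul_pow, Real.sq_sqrt hn0.le]
    nlinarith [mul_nonneg (sq_nonneg t) (sq_nonneg n)]
  have hC : ∀ z ∈ gridNet V, μ.real {H | t / 2 ≤ |centeredSum H s (quad z)|} ≤
      2 * Real.exp (-(t ^ 2 / 256)) := by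
    intro z hz
    have hz4 : ∑ i, ((z i : ℝ) / n) ^ 2 ≤ 4 := by
      unfold gridNet at hz
      exact (Finset.mem_filter.1 hz).2
    have hK : ∑ i, ∑ j, quad z i j ^ 2 ≤ 16 := by
      simp only [quad, mul_pow, ← Finset.mul_sum, ← Finset.sum_mul]
      have h0 : 0 ≤ ∑ i, ((z i : ℝ) / n) ^ 2 := by positivity
      nlinarith
    refine (binomialRandom_real_le_abs_centeredSum s (fun i j => mul_comm _ _) (by positivity) hK
      (by positivity)).trans (le_of_eq ?_)
    congr 3
    ring
  calc μ.real {H | ¬ Concentrated H s t}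
      ≤ (∑ v : V, 2 * Real.exp (-(t ^ 2 / (16 * n))) + Real.exp (-(t ^ 2 / (16 * n)))) +
          ∑ z ∈ gridNet V, 2 * Real.exp (-(t ^ 2 / 256)) := by
        refine (measureReal_mono hsub).trans ((measureReal_union_le _ _).trans ?_)
        refine add_le_add ((measureReal_union_le _ _).trans (add_le_add ?_ hB)) ?_
        · exact (measureReal_biUnion_finset_le _ _).trans (Finset.sum_le_sum hA)
        · exact (measureReal_biUnion_finset_le _ _).trans (Finset.sum_le_sum hC)
    _ ≤ _ := by
        simp only [Finset.sum_const, Finset.card_univ, nsmul_eq_mul]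
        rw [← hn]
        have hc : ((gridNet V).card : ℝ) ≤ (2 * n + 1) ^ Fintype.card V := by
          rw [hn]
          exact_mod_cast card_gridNet_le V
        have e0 : 0 ≤ 2 * Real.exp (-(t ^ 2 / 256)) := by positivity
        have := mul_le_mul_of_nonneg_right hc e0
        linarith

end

/-! ### Comparison of the fixed edge count model with `G(n, s)`. -/

section

/-- Every term of the binomial distribution with rational parameter `M / N` is at most the one
with index `M`. -/
theorem choose_mul_pow_mul_pow_le (N M : ℕ) (hM : M ≤ N) (k : ℕ) (hk : k ≤ N) :
    N.choose k * M ^ k * (N - M) ^ (N - k) ≤ N.choose M * M ^ M * (N - M) ^ (N - M) := by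
  obtain ⟨L, rfl⟩ := Nat.exists_eq_add_of_le hM
  simp only [Nat.add_sub_cancel_left]
  set T : ℕ → ℕ := fun k => (M + L).choose k * M ^ k * L ^ (M + L - k) with hT
  -- The ratio of consecutive terms is `M (N - j) / (L (j + 1))` with `N = M + L`, at least `1` for
  -- `j < M` and at most `1` for `j ≥ M`. It is stated without division because `L` may vanish.
  have key : ∀ j, j < M + L → T (j + 1) * (L * (j + 1)) = T j * (M * (M + L - j)) := by
    intro j hj
    have h1 := Nat.choose_succ_right_eq (M + L) j
    have h2 : M + L - j = (M + L - (j + 1)) + 1 := by omega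
    simp only [hT]
    calc (M + L).choose (j + 1) * M ^ (j + 1) * L ^ (M + L - (j + 1)) * (L * (j + 1))
        = ((M + L).choose (j + 1) * (j + 1)) * M ^ (j + 1) * L ^ ((M + L - (j + 1)) + 1) := by
          ring
      _ = ((M + L).choose j * (M + L - j)) * M ^ (j + 1) * L ^ (M + L - j) := by rw [h1, ← h2]
      _ = _ := by ring
  have hup : ∀ j, j < M → T j ≤ T (j + 1) := by
    intro j hj
    have hkey := key j (by omega)
    rcases Nat.eq_zero_or_pos L with rfl | hL
    · simp only [hT]
      rw [zero_pow (by omega)]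
      simp
    refine Nat.le_of_mul_le_mul_right ?_ (show 0 < L * (j + 1) by positivity)
    rw [hkey]
    refine Nat.mul_le_mul_left _ ?_
    obtain ⟨i, rfl⟩ := Nat.exists_eq_add_of_lt hj
    have : j + i + 1 + L - j = i + 1 + L := by omega
    rw [this]
    nlinarith
  have hdown : ∀ j, M ≤ j → j < M + L → T (j + 1) ≤ T j := by
    intro j hj hjN
    have hkey := key j hjN
    have hL : 0 < L := by omega
    refine Nat.le_of_mul_le_mul_right ?_ (show 0 < L * (j + 1) by positivity)
    rw [hkey]
    refine Nat.mul_le_mul_left _ ?_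
    obtain ⟨i, rfl⟩ := Nat.exists_eq_add_of_le hj
    have : M + L - (M + i) = L - i := by omega
    rw [this]
    have : L - i ≤ L := Nat.sub_le _ _
    nlinarith
  change T k ≤ (M + L).choose M * M ^ M * L ^ L
  have hTM : (M + L).choose M * M ^ M * L ^ L = T M := by simp [hT]
  rw [hTM]
  rcases le_total k M with h | h
  · induction h using Nat.decreasingInduction with
    | self => exact le_rfl
    | of_succ j hj ih => exact (hup j hj).trans (ih (by omega))
  · induction k, h using Nat.le_induction with
    | base => exact le_rfl
    | succ j hj ih => exact (hdown j hj (by omega)).trans (ih (by omega))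

/-- The `N + 1` binomial probabilities sum to `1`, and the one at the mode `M` is the largest. -/
theorem one_le_succ_mul_binomial_mode (N M : ℕ) (hM : M ≤ N) (s : ℝ) (hs : s * N = M) :
    1 ≤ (N + 1 : ℝ) * (N.choose M * (s ^ M * (1 - s) ^ (N - M))) := by
  rcases Nat.eq_zero_or_pos N with rfl | hN
  · have : M = 0 := by omega
    subst this
    simp
  have hN' : (0 : ℝ) < N := by exact_mod_cast hN
  have hsum : (1 : ℝ) = ∑ k ∈ Finset.range (N + 1), s ^ k * (1 - s) ^ (N - k) * N.choose k := by
    rw [← add_pow]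
    simp
  have hterm : ∀ k ∈ Finset.range (N + 1), s ^ k * (1 - s) ^ (N - k) * N.choose k ≤
      N.choose M * (s ^ M * (1 - s) ^ (N - M)) := by
    intro k hk
    have hk' : k ≤ N := by have := Finset.mem_range.1 hk; omega
    have hsN : s = M / N := by field_simp; exact hs
    have h1s : 1 - s = ((N - M : ℕ) : ℝ) / N := by
      rw [Nat.cast_sub hM, hsN]; field_simp
    have hrew : ∀ j, j ≤ N → s ^ j * (1 - s) ^ (N - j) =
        (M : ℝ) ^ j * ((N - M : ℕ) : ℝ) ^ (N - j) / (N : ℝ) ^ N := by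
      intro j hj
      rw [h1s, hsN, div_pow, div_pow, div_mul_div_comm, ← pow_add, Nat.add_sub_cancel' hj]
    rw [hrew k hk', hrew M hM, mul_comm, ← mul_div_assoc, ← mul_div_assoc, ← mul_assoc,
      ← mul_assoc]
    gcongr ?_ / _
    exact_mod_cast choose_mul_pow_mul_pow_le N M hM k hk'
  refine hsum.le.trans ((Finset.sum_le_sum hterm).trans (le_of_eq ?_))
  simp

variable {V : Type*} [Fintype V]

open Classical in
theorem choose_le_card_filter_ncard_edgeSet (M : ℕ) :
    ((Fintype.card V).choose 2).choose M ≤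
      (Finset.univ.filter fun H : SimpleGraph V => H.edgeSet.ncard = M).card := by
  rw [← SimpleGraph.card_edgeFinset_top_eq_card_choose_two (V := V), ← Finset.card_powersetCard]
  have hedge : ∀ t ∈ Finset.powersetCard M (⊤ : SimpleGraph V).edgeFinset,
      (SimpleGraph.fromEdgeSet (t : Set (Sym2 V))).edgeSet = t := by
    intro t ht
    rw [SimpleGraph.edgeSet_fromEdgeSet]
    ext e
    refine ⟨fun h => h.1, fun h => ⟨h, ?_⟩⟩
    have := SimpleGraph.mem_edgeFinset.1 ((Finset.mem_powersetCard.1 ht).1 h)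
    rwa [SimpleGraph.edgeSet_top] at this
  refine Finset.card_le_card_of_injOn
    (fun t => SimpleGraph.fromEdgeSet (t : Set (Sym2 V))) ?_ ?_
  · intro t ht
    simp only [Finset.coe_filter, Finset.mem_univ, true_and, Set.mem_ofPred_eq]
    rw [hedge t ht, Set.ncard_coe_finset]
    exact (Finset.mem_powersetCard.1 ht).2
  · intro t ht t' ht' h
    have := congrArg SimpleGraph.edgeSet h
    simp only at this
    rw [hedge t ht, hedge t' ht'] at this
    exact Finset.coe_injective this

open Classical in
/-- The uniform distribution on graphs with `M` edges is dominated by `G(n, M / N)`, where `N` is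
the number of possible edges, up to a factor `N + 1`. -/
theorem uniformOn_real_le_binomialRandom_real (M : ℕ) (hM : M ≤ (Fintype.card V).choose 2)
    (s : unitInterval) (hs : (s : ℝ) * (Fintype.card V).choose 2 = M)
    (A : Set (SimpleGraph V)) :
    (uniformOn {H : SimpleGraph V | H.edgeSet.ncard = M}).real A ≤
      ((Fintype.card V).choose 2 + 1) * (SimpleGraph.binomialRandom V s).real A := by
  set N := (Fintype.card V).choose 2 with hN
  -- The mass `G(n, s)` gives to each single graph with `M` edges: conditioned on having `M` edges,
  -- it is uniform.
  set w : ℝ := (s : ℝ) ^ M * (1 - (s : ℝ)) ^ (N - M) with hw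
  set S := Finset.univ.filter fun H : SimpleGraph V => H.edgeSet.ncard = M with hS
  have hw0 : 0 ≤ w := by
    have h0 := s.2.1
    have h1 : 0 ≤ 1 - (s : ℝ) := by linarith [s.2.2]
    positivity
  have hcard : (N.choose M : ℝ) ≤ S.card := by
    exact_mod_cast choose_le_card_filter_ncard_edgeSet (V := V) M
  have hSpos : (0 : ℝ) < S.card :=
    lt_of_lt_of_le (by exact_mod_cast Nat.choose_pos hM) hcard
  have hmode : 1 ≤ ((N : ℝ) + 1) * (S.card * w) := by
    refine (one_le_succ_mul_binomial_mode N M hM s hs).trans ?_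
    gcongr
  have huni : (uniformOn {H : SimpleGraph V | H.edgeSet.ncard = M}).real A =
      (S ∩ A.toFinset).card / S.card := by
    have h := uniformOn_apply_finset (s := S) (t := A.toFinset)
    have e1 : ((S : Finset (SimpleGraph V)) : Set (SimpleGraph V)) =
        {H : SimpleGraph V | H.edgeSet.ncard = M} := by simp [hS]
    rw [e1, Set.coe_toFinset] at h
    rw [Measure.real, h]
    simp
  have hbin : (S ∩ A.toFinset).card * w ≤ (SimpleGraph.binomialRandom V s).real A := by
    calc ((S ∩ A.toFinset).card : ℝ) * w
        = ∑ H ∈ S ∩ A.toFinset, (SimpleGraph.binomialRandom V s).real {H} := by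
          rw [← nsmul_eq_mul, ← Finset.sum_const]
          refine Finset.sum_congr rfl fun H hH => ?_
          have hHM : H.edgeSet.ncard = M := (Finset.mem_filter.1 (Finset.mem_inter.1 hH).1).2
          have hHM' : H.edgeFinset.card = M := by
            rw [← hHM, Set.ncard_eq_toFinset_card']
            rfl
          rw [binomialRandom_real_singleton, Finset.card_sdiff_of_subset
            (SimpleGraph.edgeFinset_mono le_top),
            SimpleGraph.card_edgeFinset_top_eq_card_choose_two, hHM']
      _ = (SimpleGraph.binomialRandom V s).real (S ∩ A.toFinset : Finset (SimpleGraph V)) :=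
          sum_measureReal_singleton _
      _ ≤ _ := measureReal_mono (by simp)
  rw [huni, div_le_iff₀ hSpos]
  calc ((S ∩ A.toFinset).card : ℝ) ≤ (S ∩ A.toFinset).card * (((N : ℝ) + 1) * (S.card * w)) :=
        le_mul_of_one_le_right (by positivity) hmode
    _ = ((N : ℝ) + 1) * ((S ∩ A.toFinset).card * w) * S.card := by ring
    _ ≤ _ := by gcongr

end

/-! ### From concentration to bounds on `lam2`. -/

section

variable {V : Type*} [Fintype V]

open Classical in
theorem lapForm_eq_sum_degree_sub (H : SimpleGraph V) (x : V → ℝ) :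
    lapForm H x = ∑ i, (H.degree i : ℝ) * x i ^ 2 -
      ∑ i, ∑ j, if H.Adj i j then x i * x j else 0 := by
  rw [← dotProduct_lapMatrix_mulVec, SimpleGraph.lapMatrix, Matrix.sub_mulVec, dotProduct_sub,
    SimpleGraph.dotProduct_mulVec_degMatrix, SimpleGraph.dotProduct_mulVec_adjMatrix]
  congr 1
  exact Finset.sum_congr rfl fun i _ => by ring

theorem centeredSum_mul_eq (H : SimpleGraph V) (s : ℝ) {x : V → ℝ} (hx : ∑ i, x i = 0) :
    centeredSum H s (fun i j => x i * x j) =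
      (open Classical in ∑ i, ∑ j, if H.Adj i j then x i * x j else 0) +
      s * ∑ i, x i ^ 2 := by
  classical
  have hterm : ∀ i j, (if i ≠ j then x i * x j * ((if H.Adj i j then 1 else 0) - s) else 0) =
      (if H.Adj i j then x i * x j else 0) - s * (x i * x j) +
        (if i = j then s * (x i * x j) else 0) := by
    intro i j
    by_cases hij : i = j
    · simp [hij]
    · by_cases h : H.Adj i j <;> simp [hij, h] <;> ring
  have h0 : ∑ i, ∑ j, s * (x i * x j) = 0 := by
    simp only [← Finset.mul_sum, hx, mul_zero, Finset.sum_const_zero]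
  unfold centeredSum
  simp only [hterm, Finset.sum_add_distrib, Finset.sum_sub_distrib]
  rw [h0, Finset.mul_sum]
  simp [sq]

/-- On vectors with sum zero, the Laplacian minus `s n` is the diagonal of degree deviations minus
the centered adjacency form; each contributes at most `t |x|²`. -/
theorem Concentrated.abs_lapForm_sub_le {H : SimpleGraph V} {s t : ℝ} (h : Concentrated H s t)
    {x : V → ℝ} (hx : ∑ i, x i = 0) :
    |lapForm H x - s * Fintype.card V * ∑ i, x i ^ 2| ≤ 2 * t * ∑ i, x i ^ 2 := by
  classical
  have e : lapForm H x - s * Fintype.card V * ∑ i, x i ^ 2 =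
      ∑ i, ((H.degree i : ℝ) - s * (Fintype.card V - 1)) * x i ^ 2 -
        centeredSum H s (fun i j => x i * x j) := by
    rw [centeredSum_mul_eq H s hx, lapForm_eq_sum_degree_sub]
    simp only [sub_mul, Finset.sum_sub_distrib, ← Finset.mul_sum]
    ring
  rw [e]
  have h1 : |∑ i, ((H.degree i : ℝ) - s * (Fintype.card V - 1)) * x i ^ 2| ≤
      t * ∑ i, x i ^ 2 := by
    refine (Finset.abs_sum_le_sum_abs _ _).trans ?_
    rw [Finset.mul_sum]
    refine Finset.sum_le_sum fun i _ => ?_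
    rw [abs_mul, abs_of_nonneg (sq_nonneg (x i))]
    exact mul_le_mul_of_nonneg_right (by convert h.degree i) (sq_nonneg _)
  have h2 := h.form x
  calc _ ≤ _ := abs_sub _ _
    _ ≤ t * ∑ i, x i ^ 2 + t * ∑ i, x i ^ 2 := add_le_add h1 h2
    _ = _ := by ring

theorem Concentrated.le_lam2_sup {Δ : SimpleGraph V} {s t : ℝ} (h : Concentrated Δ s t)
    (hV : 2 ≤ Fintype.card V) (G : SimpleGraph V) :
    s * Fintype.card V - 2 * t ≤ lam2 (G ⊔ Δ) := by
  refine le_lam2_of_forall_le_lapForm hV _ fun x hx => ?_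
  refine le_trans ?_ (lapForm_mono (le_sup_right : Δ ≤ G ⊔ Δ) x)
  have := (abs_le.1 (h.abs_lapForm_sub_le hx)).1
  linarith

open Matrix in
/-- A symmetric matrix with `0 ≤ M ≤ T` satisfies `M ^ 2 ≤ T * M` on the diagonal. -/
theorem sum_sq_row_le_mul_diag [DecidableEq V] {M : Matrix V V ℝ} (hM : M.IsSymm) {T : ℝ}
    (hT : 0 < T) (h0 : ∀ x, 0 ≤ x ⬝ᵥ M *ᵥ x) (h1 : ∀ x, x ⬝ᵥ M *ᵥ x ≤ T * (x ⬝ᵥ x)) (i : V) :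
    ∑ j, M i j ^ 2 ≤ T * M i i := by
  set e : V → ℝ := Pi.single i 1 with he
  set y : V → ℝ := M *ᵥ e with hy
  have hyj : ∀ j, y j = M i j := by
    intro j
    rw [hy, he, mulVec_single_one]
    exact hM.apply i j
  have hyy : y ⬝ᵥ y = ∑ j, M i j ^ 2 := by
    simp only [dotProduct, hyj, sq]
  have hey : e ⬝ᵥ y = M i i := by simp [he, hyj]
  have heMy : e ⬝ᵥ M *ᵥ y = y ⬝ᵥ y := by
    rw [dotProduct_mulVec, ← mulVec_transpose, hM.eq]
  -- Positivity at `T e - M e`, together with `y ⬝ᵥ M *ᵥ y ≤ T |y|²`, leaves `T |y|² ≤ T² M i i`.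
  have hexp : (T • e - y) ⬝ᵥ M *ᵥ (T • e - y) =
      T ^ 2 * M i i - 2 * T * (y ⬝ᵥ y) + y ⬝ᵥ M *ᵥ y := by
    rw [mulVec_sub, mulVec_smul, ← hy]
    simp only [dotProduct_sub, sub_dotProduct, smul_dotProduct, dotProduct_smul, smul_eq_mul,
      heMy, hey]
    ring
  have h2 := h0 (T • e - y)
  rw [hexp] at h2
  have h3 := h1 y
  rw [← hyy]
  refine le_of_mul_le_mul_left ?_ hT
  nlinarith

theorem lapForm_sub_const (H : SimpleGraph V) (x : V → ℝ) (c : ℝ) :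
    lapForm H (fun i => x i - c) = lapForm H x := by
  unfold lapForm
  simp

open Matrix Classical in
/-- If the quadratic form of the Laplacian is at most `(μ + T) |x|²` on vectors with sum zero and
all off-diagonal entries stay away from the constant `μ / n`, then a large number of edges is
needed for `μ < lam2 H`. -/
theorem card_mul_le_of_lt_lam2 (hV : 2 ≤ Fintype.card V) (H : SimpleGraph V) {μ T c : ℝ}
    (hT : 0 < T) (hc : 0 ≤ c) (hcμ : c ≤ μ / Fintype.card V) (hcμ' : μ / Fintype.card V ≤ 1 - c)
    (hup : ∀ x : V → ℝ, ∑ i, x i = 0 → lapForm H x ≤ (μ + T) * ∑ i, x i ^ 2)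
    (hlam : μ < lam2 H) :
    c ^ 2 * (Fintype.card V * (Fintype.card V - 1)) ≤
      T * (2 * H.edgeSet.ncard - μ * (Fintype.card V - 1)) := by
  set n : ℝ := ((Fintype.card V : ℕ) : ℝ) with hn
  have hn0 : 0 < n := by rw [hn]; exact_mod_cast (by omega : 0 < Fintype.card V)
  -- Subtracting `μ` times the projection onto sum zero. `M` annihilates the constants, and on sum
  -- zero it lies between `0`, since `μ < lam2 H`, and `T`.
  let M : Matrix V V ℝ := Matrix.of fun i j =>
    H.lapMatrix ℝ i j - μ * ((if i = j then 1 else 0) - 1 / n)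
  have hMsymm : M.IsSymm := by
    ext i j
    simp only [M, Matrix.transpose_apply, Matrix.of_apply]
    rw [(H.isSymm_lapMatrix (R := ℝ)).apply]
    simp only [eq_comm]
  have hform : ∀ x : V → ℝ, x ⬝ᵥ M *ᵥ x =
      lapForm H x - μ * (∑ i, x i ^ 2 - (∑ i, x i) ^ 2 / n) := by
    intro x
    rw [← dotProduct_lapMatrix_mulVec]
    have hMx : M *ᵥ x = fun i => (H.lapMatrix ℝ *ᵥ x) i - μ * (x i - (∑ j, x j) / n) := by
      ext i
      simp only [mulVec, dotProduct, M, Matrix.of_apply, sub_mul, Finset.sum_sub_distrib, mul_assoc,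
        ← Finset.mul_sum]
      simp
      left
      ring
    rw [hMx]
    simp only [dotProduct, mul_sub, Finset.sum_sub_distrib]
    have e1 : ∑ i, x i * (μ * x i) = μ * ∑ i, x i ^ 2 := by
      rw [Finset.mul_sum]
      exact Finset.sum_congr rfl fun i _ => by ring
    rw [e1, ← Finset.sum_mul]
    ring
  have hshift : ∀ x : V → ℝ, ∃ y : V → ℝ, ∑ i, y i = 0 ∧ lapForm H y = lapForm H x ∧
      ∑ i, y i ^ 2 = ∑ i, x i ^ 2 - (∑ i, x i) ^ 2 / n := by
    intro x
    refine ⟨fun i => x i - (∑ j, x j) / n, ?_, lapForm_sub_const _ _ _, ?_⟩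
    · rw [Finset.sum_sub_distrib]
      simp only [Finset.sum_const, Finset.card_univ, nsmul_eq_mul]
      rw [← hn]
      field_simp
      ring
    · have : ∀ i, (x i - (∑ j, x j) / n) ^ 2 =
          x i ^ 2 - 2 * ((∑ j, x j) / n) * x i + ((∑ j, x j) / n) ^ 2 := fun i => by ring
      simp only [this, Finset.sum_add_distrib, Finset.sum_sub_distrib, ← Finset.mul_sum,
        Finset.sum_const, Finset.card_univ, nsmul_eq_mul]
      rw [← hn]
      field_simp
      ring
  have h0 : ∀ x, 0 ≤ x ⬝ᵥ M *ᵥ x := by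
    intro x
    obtain ⟨y, hy, hyx, hyy⟩ := hshift x
    rw [hform, ← hyx, ← hyy]
    have h1 := lam2_mul_le_lapForm hV H hy
    have h2 : 0 ≤ ∑ i, y i ^ 2 := by positivity
    nlinarith
  have h1 : ∀ x, x ⬝ᵥ M *ᵥ x ≤ T * (x ⬝ᵥ x) := by
    intro x
    obtain ⟨y, hy, hyx, hyy⟩ := hshift x
    have hxx : x ⬝ᵥ x = ∑ i, x i ^ 2 := by simp [dotProduct, sq]
    have hle : ∑ i, y i ^ 2 ≤ ∑ i, x i ^ 2 := by
      rw [hyy]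
      have : 0 ≤ (∑ i, x i) ^ 2 / n := by positivity
      linarith
    rw [hform, ← hyx, ← hyy, hxx]
    have h2 := hup y hy
    have h3 := mul_le_mul_of_nonneg_left hle hT.le
    linarith
  have hrow := sum_sq_row_le_mul_diag hMsymm hT h0 h1
  have htrace : ∑ i, M i i = 2 * H.edgeSet.ncard - μ * (n - 1) := by
    rw [← sum_degree_eq_two_mul_ncard]
    have : ∀ i, M i i = (H.degree i : ℝ) - μ * (1 - 1 / n) := by
      intro i
      simp [M, SimpleGraph.lapMatrix, SimpleGraph.degMatrix]
    simp only [this, Finset.sum_sub_distrib, Finset.sum_const, Finset.card_univ, nsmul_eq_mul]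
    rw [← hn]
    field_simp
  have hentry : ∀ i j, (if i = j then 0 else c ^ 2) ≤ M i j ^ 2 := by
    intro i j
    by_cases hij : i = j
    · simp only [hij, if_true]
      positivity
    · rw [if_neg hij]
      have hMij : M i j = μ / n - (if H.Adj i j then 1 else 0) := by
        simp [M, SimpleGraph.lapMatrix, SimpleGraph.degMatrix, hij, Matrix.diagonal_apply]
        ring
      rw [hMij]
      split_ifs
      · nlinarith
      · nlinarith
  have hsum : ∑ i : V, ∑ j : V, (if i = j then 0 else c ^ 2) = c ^ 2 * (n * (n - 1)) := by
    have : ∀ i j : V, (if i = j then 0 else c ^ 2) = c ^ 2 - (if i = j then c ^ 2 else 0) := by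
      intro i j
      split_ifs <;> ring
    simp only [this, Finset.sum_sub_distrib, Finset.sum_const, Finset.card_univ, nsmul_eq_mul,
      Finset.sum_ite_eq, Finset.mem_univ, if_true]
    rw [← hn]
    ring
  -- Summed over the rows, `hrow` bounds the squared Frobenius norm by `T` times the trace.
  rw [← hsum, ← htrace, Finset.mul_sum]
  exact Finset.sum_le_sum fun i _ =>
    (Finset.sum_le_sum fun j _ => hentry i j).trans (hrow i)

open Classical in
-- Unlike the average degree bound, this tolerates an excess of order `√n t` in the edge count: such
-- an excess makes the trace small compared with what the off-diagonal entries require. The upper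
-- form bound uses `T = 2 t + 2 C`, with `2 t` from `Δ` and `2 C` from `G`.
theorem Concentrated.lam2_sup_le {Δ : SimpleGraph V} {s t : ℝ} (h : Concentrated Δ s t)
    (hV : 2 ≤ Fintype.card V) (ht : 0 < t) (G : SimpleGraph V) {C c : ℝ}
    (hC : 0 ≤ C) (hG : ∀ v, (G.degree v : ℝ) ≤ C) (hc : 0 ≤ c) (hcs : c ≤ s)
    (hcs' : s + C / Fintype.card V ≤ 1 - c)
    (hbig : (2 * t + 2 * C) * (Real.sqrt (Fintype.card V) * t + C) <
      c ^ 2 * (Fintype.card V * (Fintype.card V - 1))) :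
    lam2 (G ⊔ Δ) ≤ s * Fintype.card V + avgDegree G := by
  by_contra hcon
  rw [not_le] at hcon
  have hn0 : (0 : ℝ) < Fintype.card V := by exact_mod_cast (by omega : 0 < Fintype.card V)
  have hq0 := avgDegree_nonneg G
  have hqC := avgDegree_le_of_degree_le G hC hG
  have hμ : (s * Fintype.card V + avgDegree G) / Fintype.card V =
      s + avgDegree G / Fintype.card V := by field_simp
  have hmain := card_mul_le_of_lt_lam2 hV (G ⊔ Δ) (T := 2 * t + 2 * C) (c := c) (by positivity) hc
    (by
      rw [hμ]
      have : 0 ≤ avgDegree G / Fintype.card V := by positivity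
      linarith)
    (by
      rw [hμ]
      have : avgDegree G / Fintype.card V ≤ C / Fintype.card V := by gcongr
      linarith)
    (by
      intro x hx
      have h1 := lapForm_sup_le G Δ x
      have h2 := lapForm_le_of_degree_le G hG x
      have h3 := (abs_le.1 (h.abs_lapForm_sub_le hx)).2
      have h4 : 0 ≤ avgDegree G * ∑ i, x i ^ 2 := by positivity
      nlinarith)
    hcon
  refine absurd (hmain.trans ?_) (not_le.2 hbig)
  refine mul_le_mul_of_nonneg_left ?_ (by positivity)
  -- With `q` the average degree of `G`, the trace is at most `q n + s n (n - 1) + √n t - (s n + q)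
  -- (n - 1) = q + √n t`.
  have h1 : ((G ⊔ Δ).edgeSet.ncard : ℝ) ≤ G.edgeSet.ncard + Δ.edgeSet.ncard := by
    exact_mod_cast ncard_edgeSet_sup_le G Δ
  have h2 : 2 * (G.edgeSet.ncard : ℝ) = avgDegree G * Fintype.card V := by
    rw [avgDegree_eq, div_mul_cancel₀ _ hn0.ne']
  have h3 := h.edges
  nlinarith

end

/-! ### Asymptotic estimates. -/

theorem eventually_log_le_mul_rpow {a c : ℝ} (ha : 0 < a) (hc : 0 < c) :
    ∀ᶠ n : ℕ in atTop, Real.log (2 * n + 1) ≤ c * (n : ℝ) ^ a := by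
  have h1 : ∀ᶠ x : ℝ in atTop, Real.log x ≤ c / 3 ^ a * x ^ a := by
    filter_upwards [(isLittleO_log_rpow_atTop ha).bound (show 0 < c / 3 ^ a by positivity),
      eventually_ge_atTop 1] with x hx hx1
    rw [Real.norm_of_nonneg (Real.log_nonneg hx1), Real.norm_of_nonneg (by positivity)] at hx
    exact hx
  have h2 : Tendsto (fun n : ℕ => (2 * n + 1 : ℝ)) atTop atTop :=
    tendsto_atTop_add_const_right _ _
      (tendsto_natCast_atTop_atTop.const_mul_atTop (by norm_num : (0 : ℝ) < 2))
  filter_upwards [h2.eventually h1, eventually_ge_atTop 1] with n hn hn1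
  refine hn.trans ?_
  have hn1' : (1 : ℝ) ≤ n := by exact_mod_cast hn1
  have h3 : (2 * n + 1 : ℝ) ^ a ≤ (3 * n) ^ a :=
    Real.rpow_le_rpow (by positivity) (by linarith) ha.le
  rw [Real.mul_rpow (by norm_num) (by positivity)] at h3
  calc c / 3 ^ a * (2 * n + 1 : ℝ) ^ a ≤ c / 3 ^ a * (3 ^ a * (n : ℝ) ^ a) := by gcongr
    _ = c * (n : ℝ) ^ a := by
      have : (3 : ℝ) ^ a ≠ 0 := by positivity
      field_simp

/-- With `y = n ^ (2 k)` the net exponent is `n y / 256`; half of it absorbs `n log (2 n + 1)`, and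
the rest beats the polynomial factors. The factor `choose 2 + 1` is the price of changing the model.
-/
theorem tendsto_concentration_bound {k : ℝ} (hk : 0 < k) :
    Tendsto (fun n : ℕ => ((n.choose 2 : ℝ) + 1) *
      ((2 * n + 1) * Real.exp (-(((n : ℝ) ^ (1 / 2 + k)) ^ 2 / (16 * n))) +
        2 * (2 * n + 1) ^ n * Real.exp (-(((n : ℝ) ^ (1 / 2 + k)) ^ 2 / 256)))) atTop (𝓝 0) := by
  have h2k : 0 < 2 * k := by linarith
  have hlim : Tendsto (fun n : ℕ => 10 * (((n : ℝ) ^ (2 * k)) ^ (3 / (2 * k)) *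
      Real.exp (-(1 / 512) * (n : ℝ) ^ (2 * k)))) atTop (𝓝 0) := by
    have h := (tendsto_rpow_mul_exp_neg_mul_atTop_nhds_zero (3 / (2 * k)) (1 / 512)
      (by norm_num)).comp ((tendsto_rpow_atTop h2k).comp tendsto_natCast_atTop_atTop)
    simpa using h.const_mul 10
  refine squeeze_zero' (Eventually.of_forall fun n => by positivity) ?_ hlim
  filter_upwards [eventually_log_le_mul_rpow h2k (show (0 : ℝ) < 1 / 512 by norm_num),
    eventually_ge_atTop 1] with n hlog hn
  have hn1 : (1 : ℝ) ≤ n := by exact_mod_cast hn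
  have hn0 : (0 : ℝ) < n := by linarith
  set y := (n : ℝ) ^ (2 * k) with hy
  have hy0 : 0 ≤ y := by positivity
  have ht : ((n : ℝ) ^ (1 / 2 + k)) ^ 2 = n * y := by
    rw [← Real.rpow_natCast, ← Real.rpow_mul hn0.le, hy]
    nth_rewrite 2 [← Real.rpow_one (n : ℝ)]
    rw [← Real.rpow_add hn0]
    congr 1
    push_cast
    ring
  have hy3 : y ^ (3 / (2 * k)) = (n : ℝ) ^ 3 := by
    rw [hy, ← Real.rpow_mul hn0.le, mul_div_cancel₀ _ h2k.ne']
    norm_cast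
  rw [ht, hy3]
  have e1 : Real.exp (-(n * y / (16 * n))) ≤ Real.exp (-(1 / 512) * y) := by
    apply Real.exp_le_exp.2
    rw [mul_comm (16 : ℝ), mul_div_mul_left _ _ hn0.ne']
    linarith
  have e2 : (2 * n + 1 : ℝ) ^ n * Real.exp (-(n * y / 256)) ≤ Real.exp (-(1 / 512) * y) := by
    rw [← Real.exp_log (show (0 : ℝ) < 2 * n + 1 by positivity), ← Real.exp_nat_mul,
      ← Real.exp_add]
    apply Real.exp_le_exp.2
    have h1 := mul_le_mul_of_nonneg_left hlog hn0.le
    have h2 := mul_le_mul_of_nonneg_right hn1 hy0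
    linarith
  have e3 : (n.choose 2 : ℝ) + 1 ≤ 2 * n ^ 2 := by
    rw [Nat.cast_choose_two]
    nlinarith
  have e4 : (0 : ℝ) ≤ (n.choose 2 : ℝ) + 1 := by positivity
  set E := Real.exp (-(1 / 512) * y)
  have hE : 0 ≤ E := Real.exp_nonneg _
  calc _ ≤ (2 * (n : ℝ) ^ 2) * ((2 * n + 1) * E + 2 * E) := by
        refine mul_le_mul e3 (add_le_add ?_ ?_) (by positivity) (by positivity)
        · exact mul_le_mul_of_nonneg_left e1 (by positivity)
        · rw [mul_assoc]
          exact mul_le_mul_of_nonneg_left e2 (by norm_num)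
    _ = (4 * (n : ℝ) ^ 3 + 6 * (n : ℝ) ^ 2) * E := by ring
    _ ≤ 10 * (n : ℝ) ^ 3 * E := by
        refine mul_le_mul_of_nonneg_right ?_ hE
        have : (n : ℝ) ^ 2 ≤ (n : ℝ) ^ 3 := pow_le_pow_right₀ hn1 (by norm_num)
        linarith
    _ = _ := by ring

theorem eventually_add_const_mul_rpow_le (A B : ℝ) {a b η : ℝ} (ha : 0 ≤ a) (hab : a < b)
    (hη : 0 < η) : ∀ᶠ n : ℕ in atTop, A + B * (n : ℝ) ^ a ≤ η * (n : ℝ) ^ b := by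
  have h1 : Tendsto (fun n : ℕ => (n : ℝ) ^ (b - a)) atTop atTop :=
    (tendsto_rpow_atTop (by linarith)).comp tendsto_natCast_atTop_atTop
  filter_upwards [h1.eventually_ge_atTop ((|A| + B) / η), eventually_ge_atTop 1] with n hn hn1
  have hn1' : (1 : ℝ) ≤ n := by exact_mod_cast hn1
  have hn0 : (0 : ℝ) < n := by linarith
  have hna : 1 ≤ (n : ℝ) ^ a := Real.one_le_rpow hn1' ha
  have hb : (n : ℝ) ^ b = (n : ℝ) ^ a * (n : ℝ) ^ (b - a) := by
    rw [← Real.rpow_add hn0]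
    congr 1
    ring
  rw [div_le_iff₀ hη] at hn
  have h2 := mul_le_mul_of_nonneg_right hn (by linarith : 0 ≤ (n : ℝ) ^ a)
  have h3 : A ≤ |A| * (n : ℝ) ^ a :=
    (le_abs_self A).trans (le_mul_of_one_le_right (abs_nonneg A) hna)
  rw [hb]
  linarith

/-- For `t = n ^ (5 / 8)` the product is of order `√n t² = n ^ (7 / 4)`, below `n²`. -/
theorem eventually_deviation_product_lt (C : ℝ) {c : ℝ} (hC : 0 ≤ C) (hc : 0 < c) :
    ∀ᶠ n : ℕ in atTop, (2 * (n : ℝ) ^ (1 / 2 + 1 / 8 : ℝ) + 2 * C) *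
      (Real.sqrt n * (n : ℝ) ^ (1 / 2 + 1 / 8 : ℝ) + C) < c * (n * (n - 1)) := by
  filter_upwards [eventually_add_const_mul_rpow_le 0 (4 * (1 + C) ^ 2) (a := 7 / 4) (b := 2)
    (η := c / 2) (by norm_num) (by norm_num) (by linarith), eventually_ge_atTop 3] with n hn hn3
  have hn3' : (3 : ℝ) ≤ n := by exact_mod_cast hn3
  have hn0 : (0 : ℝ) < n := by linarith
  set t := (n : ℝ) ^ (1 / 2 + 1 / 8 : ℝ) with ht
  have ht1 : 1 ≤ t := Real.one_le_rpow (by linarith) (by norm_num)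
  have hs1 : 1 ≤ Real.sqrt n := Real.one_le_sqrt.2 (by linarith)
  have hprod : t * (Real.sqrt n * t) = (n : ℝ) ^ (7 / 4 : ℝ) := by
    rw [Real.sqrt_eq_rpow, ht, ← Real.rpow_add hn0, ← Real.rpow_add hn0]
    norm_num
  have hn2 : (n : ℝ) ^ (2 : ℝ) = (n : ℝ) ^ 2 := by norm_cast
  have hst : 1 ≤ Real.sqrt n * t := one_le_mul_of_one_le_of_one_le hs1 ht1
  have e1 : 2 * t + 2 * C ≤ 2 * (1 + C) * t := by nlinarith
  have e2 : Real.sqrt n * t + C ≤ (1 + C) * (Real.sqrt n * t) := by nlinarith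
  calc _ ≤ (2 * (1 + C) * t) * ((1 + C) * (Real.sqrt n * t)) :=
        mul_le_mul e1 e2 (by positivity) (by positivity)
    _ = 2 * (1 + C) ^ 2 * (t * (Real.sqrt n * t)) := by ring
    _ < 0 + 4 * (1 + C) ^ 2 * (n : ℝ) ^ (7 / 4 : ℝ) := by
        rw [hprod]
        have : 0 < (1 + C) ^ 2 * (n : ℝ) ^ (7 / 4 : ℝ) := by positivity
        linarith
    _ ≤ c / 2 * (n : ℝ) ^ 2 := by rw [← hn2]; exact hn
    _ ≤ c * (n * (n - 1)) := by
        have h : (n : ℝ) ^ 2 / 2 ≤ n * (n - 1) := by nlinarith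
        have := mul_le_mul_of_nonneg_left h hc.le
        linarith

/-! ### Assembly for the two random models. -/

theorem measurableSet_simpleGraph {V : Type*} [Fintype V] (A : Set (SimpleGraph V)) :
    MeasurableSet A := by
  classical
  exact A.toFinite.measurableSet

theorem floor_mul_choose_le (p : unitInterval) (N : ℕ) : ⌊(p : ℝ) * (N : ℝ)⌋₊ ≤ N := by
  have : (p : ℝ) * N ≤ N := mul_le_of_le_one_left (by positivity) p.2.2
  exact_mod_cast (Nat.floor_mono this).trans (Nat.floor_natCast N).le

theorem nonempty_setOf_ncard_edgeSet_eq (V : Type*) [Fintype V] {M : ℕ}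
    (hM : M ≤ (Fintype.card V).choose 2) :
    {H : SimpleGraph V | H.edgeSet.ncard = M}.Nonempty := by
  classical
  have h := (Nat.choose_pos hM).trans_le (choose_le_card_filter_ncard_edgeSet (V := V) M)
  obtain ⟨H, hH⟩ := Finset.card_pos.1 h
  exact ⟨H, (Finset.mem_filter.1 hH).2⟩

instance isProbabilityMeasure_fixedFractionRandom (V : Type*) [Fintype V] (p : unitInterval) :
    IsProbabilityMeasure (fixedFractionRandom V p) :=
  isProbabilityMeasure_uniformOn (Set.toFinite _)
    (nonempty_setOf_ncard_edgeSet_eq V (floor_mul_choose_le p _))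

/-- Both random graph models are dominated by `G(n, s)` with `s` close to `p`, up to a polynomial
factor. -/
theorem exists_binomialRandom_dominating {V : Type*} [Fintype V] (hV : 2 ≤ Fintype.card V)
    (p : unitInterval) (P : Measure (SimpleGraph V))
    (hP : P = fixedFractionRandom V p ∨ P = SimpleGraph.binomialRandom V p) :
    ∃ s : unitInterval, ((p : ℝ) - s) * Fintype.card V ≤ 2 ∧ ∀ A : Set (SimpleGraph V),
      P.real A ≤ ((Fintype.card V).choose 2 + 1) * (SimpleGraph.binomialRandom V s).real A := by
  rcases hP with rfl | rfl
  · set N := (Fintype.card V).choose 2 with hN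
    set M := ⌊(p : ℝ) * (N : ℝ)⌋₊ with hM
    have hMN : M ≤ N := floor_mul_choose_le p N
    have hN0 : (0 : ℝ) < N := by exact_mod_cast Nat.choose_pos hV
    have hMN' : (M : ℝ) ≤ N := by exact_mod_cast hMN
    -- The parameter is `M / N` instead of `p`, so that `M` is the mode. Rounding costs `p - s ≤ 1 /
    -- N`, and `n ≤ 2 N`, so `s n` loses at most `2`.
    refine ⟨⟨(M : ℝ) / N, by positivity, (div_le_one hN0).2 hMN'⟩, ?_, fun A => ?_⟩
    · have h1 : (p : ℝ) * N < M + 1 := Nat.lt_floor_add_one _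
      have h2 : ((p : ℝ) - M / N) * N ≤ 1 := by
        rw [sub_mul, div_mul_cancel₀ _ hN0.ne']
        linarith
      have hn2 : (2 : ℝ) ≤ Fintype.card V := by exact_mod_cast hV
      have h3 : (Fintype.card V : ℝ) ≤ 2 * N := by
        rw [hN, Nat.cast_choose_two]
        nlinarith
      have h4 : 0 ≤ (p : ℝ) - M / N := by
        rw [sub_nonneg, div_le_iff₀ hN0]
        exact Nat.floor_le (mul_nonneg p.2.1 hN0.le)
      have h5 := mul_le_mul_of_nonneg_left h3 h4
      simp only
      linarith
    · exact uniformOn_real_le_binomialRandom_real M hMN _ (div_mul_cancel₀ _ hN0.ne') A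
  · refine ⟨p, by simp, fun A => le_mul_of_one_le_left measureReal_nonneg ?_⟩
    have : (0 : ℝ) ≤ (Fintype.card V).choose 2 := by positivity
    linarith

theorem eventually_lam2_sup_le {d : ℕ} (hd : 1 ≤ d) (p : unitInterval)
    (G : ∀ r : ℕ, SimpleGraph (Lattice d r))
    (hG : LocallyConnectedCube G ∨ LocallyConnectedTorus G) :
    ∀ᶠ r in atTop, ∀ Δ : SimpleGraph (Lattice d r),
      (Δ.edgeSet.ncard : ℝ) ≤ (p : ℝ) * ((Fintype.card (Lattice d r)).choose 2 : ℝ) →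
      lam2 (G r ⊔ Δ) ≤ (p : ℝ) * (Fintype.card (Lattice d r) : ℝ) + avgDegree (G r) := by
  classical
  obtain ⟨C, hC⟩ := exists_degree_le G hG
  have hcard := tendsto_card_lattice hd
  have hn := tendsto_natCast_atTop_atTop (R := ℝ) |>.comp hcard
  rcases p.2.2.eq_or_lt with hp | hp
  · filter_upwards [hcard.eventually_ge_atTop 2] with r hr Δ _
    rw [hp, one_mul]
    exact (lam2_le_card hr _).trans (le_add_of_nonneg_right (avgDegree_nonneg _))
  · have hp' : 0 < 1 - (p : ℝ) := by linarith
    filter_upwards [hcard.eventually_ge_atTop 2,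
      hn.eventually_ge_atTop (C / (1 - (p : ℝ)) + 2)] with r hr hr2 Δ hΔ
    refine lam2_sup_le_of_avgDegree_lt hr _ _ p.2.1 hΔ ?_
    refine (avgDegree_le_of_degree_le (G r) (C := C) (by positivity)
      fun v => by exact_mod_cast hC r v).trans_lt ?_
    have h : (C : ℝ) / (1 - p) < Fintype.card (Lattice d r) - 1 := by
      simp only [Function.comp_apply] at hr2
      linarith
    rwa [div_lt_iff₀ hp', mul_comm] at h

open Classical in
theorem tendsto_real_not_concentrated {d : ℕ} (hd : 1 ≤ d)
    (P : ∀ r : ℕ, Measure (SimpleGraph (Lattice d r))) (s : ℕ → unitInterval)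
    (hPs : ∀ᶠ r in atTop, ∀ A : Set (SimpleGraph (Lattice d r)), (P r).real A ≤
      ((Fintype.card (Lattice d r)).choose 2 + 1) *
        (SimpleGraph.binomialRandom (Lattice d r) (s r)).real A) {k : ℝ} (hk : 0 < k) :
    Tendsto (fun r => (P r).real {Δ | ¬ Concentrated Δ (s r)
      ((Fintype.card (Lattice d r) : ℝ) ^ (1 / 2 + k))}) atTop (𝓝 0) := by
  have hcard := tendsto_card_lattice hd
  refine squeeze_zero' (Eventually.of_forall fun r => measureReal_nonneg) ?_
    ((tendsto_concentration_bound hk).comp hcard)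
  have hlarge := hcard.eventually (eventually_add_const_mul_rpow_le 0 6
    (a := 1 / 2) (b := 1 / 2 + k) (η := 1) (by norm_num) (by linarith) one_pos)
  filter_upwards [hPs, hcard.eventually_ge_atTop 1, hlarge] with r hr hr1 hr2
  refine (hr _).trans ?_
  refine mul_le_mul_of_nonneg_left ?_ (by positivity)
  refine binomialRandom_real_not_concentrated_le hr1 (s r) ?_
  rw [Real.sqrt_eq_rpow]
  linarith

theorem tendsto_real_lt_lam2_sup {d : ℕ} (hd : 1 ≤ d) (p : unitInterval)
    (G : ∀ r : ℕ, SimpleGraph (Lattice d r))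
    (hG : LocallyConnectedCube G ∨ LocallyConnectedTorus G)
    (P : ∀ r : ℕ, Measure (SimpleGraph (Lattice d r)))
    (hP : (∀ r, P r = fixedFractionRandom (Lattice d r) p) ∨
        (∀ r, P r = SimpleGraph.binomialRandom (Lattice d r) p)) :
    Tendsto (fun r => (P r).real {Δ | ¬ lam2 (G r ⊔ Δ) ≤
      (p : ℝ) * (Fintype.card (Lattice d r) : ℝ) + avgDegree (G r)}) atTop (𝓝 0) := by
  classical
  have hdet := eventually_lam2_sup_le hd p G hG
  have hcard := tendsto_card_lattice hd
  rcases hP with hP | hP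
  -- With a fixed edge count the deterministic bound makes the exceptional event null for all large
  -- `r`.
  · refine tendsto_const_nhds.congr' ?_
    filter_upwards [hdet] with r hr
    rw [hP, fixedFractionRandom, Measure.real, eq_comm, ENNReal.toReal_eq_zero_iff]
    left
    rw [uniformOn_eq_zero_iff (Set.toFinite _), Set.eq_empty_iff_forall_notMem]
    rintro Δ ⟨hΔ, hΔ'⟩
    refine hΔ' (hr Δ ?_)
    rw [show Δ.edgeSet.ncard = _ from hΔ]
    exact Nat.floor_le (mul_nonneg p.2.1 (by positivity))
  rcases p.2.1.eq_or_lt with hp0 | hp0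
  · have hp : p = 0 := Subtype.ext hp0.symm
    refine tendsto_const_nhds.congr' ?_
    filter_upwards [hdet] with r hr
    have hbot := hr ⊥ (by simp [hp])
    rw [hP, hp, SimpleGraph.binomialRandom_zero, Measure.real,
      Measure.dirac_apply' _ (measurableSet_simpleGraph _), Set.indicator_of_notMem]
    · simp
    · rw [hp] at hbot
      simpa using hbot
  rcases p.2.2.eq_or_lt with hp1 | hp1
  · refine tendsto_const_nhds.congr' ?_
    filter_upwards [hcard.eventually_ge_atTop 2] with r hr
    have : {Δ : SimpleGraph (Lattice d r) | ¬ lam2 (G r ⊔ Δ) ≤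
        (p : ℝ) * (Fintype.card (Lattice d r) : ℝ) + avgDegree (G r)} = ∅ := by
      rw [Set.eq_empty_iff_forall_notMem]
      intro Δ hΔ
      refine hΔ ?_
      rw [hp1, one_mul]
      exact (lam2_le_card hr _).trans (le_add_of_nonneg_right (avgDegree_nonneg _))
    rw [this, measureReal_empty]
  · obtain ⟨C, hC⟩ := exists_degree_le G hG
    have hC0 : (0 : ℝ) ≤ C := by positivity
    -- Positive because `0 < p < 1`. The first entry keeps `μ / n ≥ c`; the second leaves room `(1 -
    -- p) / 2` for the term `C / n`.
    set c : ℝ := min (p : ℝ) ((1 - (p : ℝ)) / 2) with hc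
    have hc0 : 0 < c := lt_min hp0 (by linarith)
    have hcp : c ≤ p := min_le_left _ _
    have hcp' : c ≤ (1 - (p : ℝ)) / 2 := min_le_right _ _
    have hconc := tendsto_real_not_concentrated hd P (fun _ => p)
      (Eventually.of_forall fun r A => by
        rw [hP]
        refine le_mul_of_one_le_left measureReal_nonneg ?_
        have : (0 : ℝ) ≤ (Fintype.card (Lattice d r)).choose 2 := by positivity
        linarith) (k := 1 / 8) (by norm_num)
    refine squeeze_zero' (Eventually.of_forall fun r => measureReal_nonneg) ?_ hconc
    have hn := tendsto_natCast_atTop_atTop (R := ℝ) |>.comp hcard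
    filter_upwards [hcard.eventually (eventually_deviation_product_lt C (c := c ^ 2) hC0
      (by positivity)), hcard.eventually_ge_atTop 2,
      hn.eventually_ge_atTop (C / ((1 - (p : ℝ)) / 2))] with r hbig hr2 hrC
    have : IsProbabilityMeasure (P r) := by rw [hP]; infer_instance
    have hn0 : (0 : ℝ) < Fintype.card (Lattice d r) := by
      exact_mod_cast (by omega : 0 < Fintype.card (Lattice d r))
    refine measureReal_mono fun Δ hΔ hcon => hΔ ?_
    refine hcon.lam2_sup_le hr2 (by positivity) (G r) hC0
      (fun v => by exact_mod_cast hC r v) hc0.le hcp ?_ hbig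
    simp only [Function.comp_apply] at hrC
    rw [div_le_iff₀ (by linarith), mul_comm, ← div_le_iff₀ hn0] at hrC
    linarith

theorem tendsto_real_lt_abs_lam2_sub {d : ℕ} (hd : 1 ≤ d) (p : unitInterval)
    (G : ∀ r : ℕ, SimpleGraph (Lattice d r))
    (hG : LocallyConnectedCube G ∨ LocallyConnectedTorus G)
    (P : ∀ r : ℕ, Measure (SimpleGraph (Lattice d r)))
    (hP : (∀ r, P r = fixedFractionRandom (Lattice d r) p) ∨
        (∀ r, P r = SimpleGraph.binomialRandom (Lattice d r) p))
    {ε η : ℝ} (hε : 0 < ε) (hη : 0 < η) :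
    Tendsto (fun r => (P r).real {Δ | η * (Fintype.card (Lattice d r) : ℝ) ^ (1 / 2 + ε : ℝ) <
      |lam2 (G r ⊔ Δ) - (p : ℝ) * (Fintype.card (Lattice d r) : ℝ)|}) atTop (𝓝 0) := by
  classical
  have hcard := tendsto_card_lattice hd
  obtain ⟨C, hC⟩ := exists_degree_le G hG
  have hprob : ∀ r, IsProbabilityMeasure (P r) := by
    intro r
    rcases hP with h | h <;> rw [h] <;> infer_instance
  have hdom : ∀ r, ∃ s : unitInterval, 2 ≤ Fintype.card (Lattice d r) →
      ((p : ℝ) - s) * Fintype.card (Lattice d r) ≤ 2 ∧ ∀ A : Set (SimpleGraph (Lattice d r)),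
      (P r).real A ≤ ((Fintype.card (Lattice d r)).choose 2 + 1) *
        (SimpleGraph.binomialRandom (Lattice d r) s).real A := by
    intro r
    by_cases hr : 2 ≤ Fintype.card (Lattice d r)
    · obtain ⟨s, hs⟩ := exists_binomialRandom_dominating hr p (P r)
        (hP.imp (fun h => h r) (fun h => h r))
      exact ⟨s, fun _ => hs⟩
    · exact ⟨0, fun h => absurd h hr⟩
  choose s hs using hdom
  have hconc := tendsto_real_not_concentrated hd P s
    (by filter_upwards [hcard.eventually_ge_atTop 2] with r hr using (hs r hr).2)
    (k := ε / 2) (by linarith)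
  have hupper := tendsto_real_lt_lam2_sup hd p G hG P hP
  have hsum := hconc.add hupper
  rw [add_zero] at hsum
  refine squeeze_zero' (Eventually.of_forall fun r => measureReal_nonneg) ?_ hsum
  filter_upwards [hcard.eventually_ge_atTop 2, hcard.eventually
    (eventually_add_const_mul_rpow_le (C + 2) 2 (a := 1 / 2 + ε / 2) (b := 1 / 2 + ε)
      (by linarith) (by linarith) hη)] with r hr2 hr
  refine (measureReal_mono ?_).trans (measureReal_union_le _ _)
  intro Δ hΔ
  by_contra hcon
  simp only [Set.mem_union, Set.mem_ofPred_eq, not_or, not_not] at hcon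
  obtain ⟨h1, h2⟩ := hcon
  -- The deviation lies between `-(2 + 2 t)` and `C`, where `t = n ^ (1 / 2 + ε / 2)`; halving `ε`
  -- makes this eventually smaller than `η n ^ (1 / 2 + ε)`.
  refine absurd hΔ (not_lt.2 (le_trans ?_ hr))
  have hlow := h1.le_lam2_sup hr2 (G r)
  have hq := avgDegree_le_of_degree_le (G r) (C := C) (by positivity)
    fun v => by exact_mod_cast hC r v
  have hps := (hs r hr2).1
  have ht : 0 ≤ (Fintype.card (Lattice d r) : ℝ) ^ (1 / 2 + ε / 2) := by positivity
  rw [abs_le]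
  constructor
  · have : (0 : ℝ) ≤ C := by positivity
    linarith
  · linarith

theorem tendsto_measure_of_tendsto_real {Ω : ℕ → Type*} [∀ r, MeasurableSpace (Ω r)]
    {P : ∀ r, Measure (Ω r)} [∀ r, IsFiniteMeasure (P r)] {A : ∀ r, Set (Ω r)} {a : ℝ}
    (h : Tendsto (fun r => (P r).real (A r)) atTop (𝓝 a)) :
    Tendsto (fun r => P r (A r)) atTop (𝓝 (ENNReal.ofReal a)) := by
  refine (ENNReal.tendsto_ofReal h).congr fun r => ?_
  exact ofReal_measureReal

end RandomCoupling

open RandomCoupling in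
theorem mainTheorem2 (d : ℕ) (hd : 1 ≤ d) (p : unitInterval)
    (G : ∀ r : ℕ, SimpleGraph (Lattice d r))
    (hG : LocallyConnectedCube G ∨ LocallyConnectedTorus G)
    (n : ℕ → ℕ) (hn : ∀ r, n r = Fintype.card (Lattice d r)) :
    -- the upper bound, for every choice of at most a fraction `p` of all possible edges
    (∀ r : ℕ, 1 ≤ r → ∀ Δ : SimpleGraph (Lattice d r),
      (Δ.edgeSet.ncard : ℝ) ≤ (p : ℝ) * ((n r).choose 2 : ℝ) →
      (G r ⊔ Δ ≠ ⊤ ∨ p = 1) →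
      lam2 (G r ⊔ Δ) ≤ (p : ℝ) * (n r : ℝ) + avgDegree (G r)) ∧
    (∀ᶠ r in atTop, ∀ Δ : SimpleGraph (Lattice d r),
      (Δ.edgeSet.ncard : ℝ) ≤ (p : ℝ) * ((n r).choose 2 : ℝ) →
      lam2 (G r ⊔ Δ) ≤ (p : ℝ) * (n r : ℝ) + avgDegree (G r)) ∧
    -- random choice of the added edges, exact fraction or independently with probability `p`
    (∀ P : ∀ r : ℕ, Measure (SimpleGraph (Lattice d r)),
      ((∀ r, P r = fixedFractionRandom (Lattice d r) p) ∨
        (∀ r, P r = SimpleGraph.binomialRandom (Lattice d r) p)) →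
      Tendsto (fun r => P r {Δ | lam2 (G r ⊔ Δ) ≤ (p : ℝ) * (n r : ℝ) + avgDegree (G r)})
        atTop (𝓝 1) ∧
      (∀ ε : ℝ, 0 < ε → ∀ η : ℝ, 0 < η →
        Tendsto (fun r => P r {Δ | η * (n r : ℝ) ^ (1 / 2 + ε : ℝ) <
          |lam2 (G r ⊔ Δ) - (p : ℝ) * (n r : ℝ)|}) atTop (𝓝 0)) ∧
      (∀ η : ℝ, 0 < η →
        Tendsto (fun r => P r {Δ | η < |lam2 (G r ⊔ Δ) / (n r : ℝ) - (p : ℝ)|})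
          atTop (𝓝 0))) := by
  obtain rfl : n = fun r => Fintype.card (Lattice d r) := funext hn
  have hcard := tendsto_card_lattice hd
  refine ⟨fun r hr Δ hΔ htop => ?_, eventually_lam2_sup_le hd p G hG, fun P hP => ?_⟩
  · have hV : 2 ≤ Fintype.card (Lattice d r) := by
      rw [card_lattice]
      exact (by omega : 2 ≤ r + 1).trans (Nat.le_self_pow (by omega) _)
    rcases htop with h | rfl
    · exact lam2_sup_le_of_ne_top hV _ _ p.2.1 hΔ h
    · refine (lam2_le_card hV _).trans ?_
      simpa using avgDegree_nonneg (G r)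
  · have hprob : ∀ r, IsProbabilityMeasure (P r) := by
      intro r
      rcases hP with h | h <;> rw [h] <;> infer_instance
    have hdev := fun {ε η : ℝ} (hε : 0 < ε) (hη : 0 < η) =>
      tendsto_real_lt_abs_lam2_sub hd p G hG P hP hε hη
    refine ⟨?_, fun ε hε η hη => ?_, fun η hη => ?_⟩
    · have h := (tendsto_real_lt_lam2_sup hd p G hG P hP).const_sub 1
      rw [sub_zero] at h
      rw [← ENNReal.ofReal_one]
      refine tendsto_measure_of_tendsto_real (h.congr fun r => ?_)
      rw [← probReal_compl_eq_one_sub (measurableSet_simpleGraph _)]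
      congr 1
      ext Δ
      simp
    · rw [← ENNReal.ofReal_zero]
      exact tendsto_measure_of_tendsto_real (hdev hε hη)
    · rw [← ENNReal.ofReal_zero]
      refine tendsto_measure_of_tendsto_real
        -- The case `ε = 1 / 2`, where the allowed deviation is `η n`.
        ((hdev (show (0 : ℝ) < 1 / 2 by norm_num) hη).congr' ?_)
      filter_upwards [hcard.eventually_ge_atTop 1] with r hr
      have hn0 : (0 : ℝ) < Fintype.card (Lattice d r) := by exact_mod_cast hr
      congr 1
      ext Δ
      simp only [Set.mem_ofPred_eq]
      rw [add_halves, Real.rpow_one, ← lt_div_iff₀ hn0, ← abs_of_pos hn0, ← abs_div,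
        abs_of_pos hn0, sub_div, mul_div_cancel_right₀ _ hn0.ne']
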